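/- Let $G$ and $H$ be discrete groups with units denoted by $e$, let $\mathcal A=(A_g)_{g\in G}$ and $\mathcal B=(B_h)_{h\in H}$ be Fell bundles over $G$ and $H$, and let $\varphi:G\to H$ be a group homomorphism whose kernel is amenable. Let $C_c(\mathcal A)$ denote the space of finitely supported sections of $\mathcal A$, let $\ell^2(\mathcal A)$ be the right Hilbert $A_e$-module obtained by completing $C_c(\mathcal A)$ for the inner product $\langle f_1,f_2\rangle=\sum_{h\in G}f_1(h)^*f_2(h)$, and let $\lambda^{\mathcal A}_g(a)$, for $g\in G$ and $a\in A_g$, be the adjointable operator on $\ell^2(\mathcal A)$ determined by $(\lambda^{\mathcal A}_g(a)f)(h)=a\,f(g^{-1}h)$ for $f\in C_c(\mathcal A)$, $h\in G$. Let $C_r^*(\mathcal A)$ be the $C^*$-algebra of adjointable operators on $\ell^2(\mathcal A)$ generated by all $\lambda^{\mathcal A}_g(a)$, and put $\|f\|_r=\big\|\sum_{g}\lambda^{\mathcal A}_g(f(g))\big\|$ for $f\in C_c(\mathcal A)$; similarly for $\mathcal B$. Let $T=(T_g)_{g\in G}$ be an $\mathcal A$-$\varphi$-$\mathcal B$ bundle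 map, that is, a family of bounded linear maps $T_g:A_g\to B_{\varphi(g)}$. Call $T$ \emph{positive definite} if $$\sum_{i,j=1}^n b_i\,T_{g_i^{-1}g_j}(a_i^*a_j)\,b_j^*\ \geq 0\quad\text{in } B_e$$ for all $n\in\mathbb N$, $g_1,\dots,g_n\in G$, $a_i\in A_{g_i}$ and $b_i\in B_{\varphi(g_i)}$. Call $T$ \emph{reduced} if the linear map $\phi_T:C_c(\mathcal A)\to C_c(\mathcal B)$ that sends the section supported at $g$ with value $a\in A_g$ to the section supported at $\varphi(g)$ with value $T_g(a)$ is bounded for the norms $\|\cdot\|_r$; equivalently, if there is a (necessarily unique) bounded linear map $M_T:C_r^*(\mathcal A)\to C_r^*(\mathcal B)$ such that $M_T(\lambda^{\mathcal A}_g(a))=\lambda^{\mathcal B}_{\varphi(g)}(T_g(a))$ for all $g\in G$ and $a\in A_g$. Then $T$ is positive definite if and only if $T$ is reduced and $M_T:C_r^*(\mathcal A)\to C_r^*(\mathcal B)$ is completely positive. In that case $\|M_T\|=\|T_e\|$. -/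

import Mathlib

universe u v w w'

noncomputable section

open UniformSpace MulOpposite
open scoped ComplexOrder InnerProductSpace CStarAlgebra

/-! ### Hilbert C⋆-modules: completion, and the C⋆-algebra of adjointable operators -/

section HilbertModule

set_option linter.unusedSectionVars false

variable {R E : Type*} [NonUnitalCStarAlgebra R] [PartialOrder R] [StarOrderedRing R]
  [NormedAddCommGroup E] [NormedSpace ℂ E] [SMul R E] [CStarModule R E]

theorem CStarModule.ext_inner_right {x y : E} (h : ∀ z : E, ⟪z, x⟫_R = ⟪z, y⟫_R) : x = y := by
  rw [← sub_eq_zero, ← CStarModule.inner_self (A := R)]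
  simp [h]

variable (R) in
theorem CStarModule.smul_sub' (a : R) (x y : E) : a • (x - y) = a • x - a • y :=
  CStarModule.ext_inner_right (R := R) fun z => by simp [mul_sub]

variable (R) in
theorem CStarModule.norm_smul_le' (a : R) (x : E) : ‖a • x‖ ≤ ‖a‖ * ‖x‖ := by
  refine abs_le_of_sq_le_sq' ?_ (by positivity) |>.2
  rw [CStarModule.norm_sq_eq R, CStarModule.inner_op_smul_right, CStarModule.inner_op_smul_left,
    mul_pow, CStarModule.norm_sq_eq R (x := x)]
  calc _ ≤ ‖a‖ * (‖⟪x, x⟫_R‖ * ‖star a‖) :=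
        (norm_mul_le _ _).trans (by gcongr; exact norm_mul_le _ _)
    _ = _ := by rw [norm_star]; ring

variable (R E) in
theorem CStarModule.uniformContinuousConstSMul : UniformContinuousConstSMul R E where
  uniformContinuous_const_smul a :=
    (LipschitzWith.of_dist_le_mul (K := ‖a‖₊) fun x y => by
      rw [dist_eq_norm, dist_eq_norm, ← CStarModule.smul_sub']
      exact CStarModule.norm_smul_le' R a (x - y)).uniformContinuous

theorem completion_inner_coe (x y : E) :
    ⟪(x : Completion E), (y : Completion E)⟫_R = ⟪x, y⟫_R :=
  (Completion.isDenseInducing_coe.prodMap Completion.isDenseInducing_coe).extend_eq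
    (CStarModule.continuous_inner : Continuous (Function.uncurry (inner R (E := E)))) (x, y)

variable (R E) in
theorem completion_continuous_inner :
    Continuous (Function.uncurry (inner R (E := Completion E))) := by
  let inner' : E →+ E →+ R :=
    { toFun := fun x => (CStarModule.innerₛₗ (A := R) x).toAddMonoidHom
      map_zero' := by ext x; simp
      map_add' := fun x y => by ext z; simp [CStarModule.innerₛₗ_apply] }
  have : Continuous fun p : E × E => inner' p.1 p.2 := CStarModule.continuous_inner
  rw [Completion.toInner, inner, Function.uncurry_curry _]
  change
    Continuous
      (((Completion.isDenseInducing_toCompl E).prodMap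
        (Completion.isDenseInducing_toCompl E)).extend fun p : E × E => inner' p.1 p.2)
  exact (Completion.isDenseInducing_toCompl E).extend_Z_bilin
    (Completion.isDenseInducing_toCompl E) this

variable (R E) in
theorem completion_inner_cont {X : Type*} [TopologicalSpace X] {f g : X → Completion E}
    (hf : Continuous f) (hg : Continuous g) : Continuous fun t => ⟪f t, g t⟫_R :=
  (completion_continuous_inner R E).comp (hf.prodMk hg)

variable (R) in
theorem completion_norm_eq (x : Completion E) : ‖x‖ = √‖⟪x, x⟫_R‖ := by
  have hc := completion_inner_cont R E (X := Completion E) continuous_id continuous_id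
  refine Completion.induction_on x (isClosed_eq continuous_norm
    (Real.continuous_sqrt.comp (continuous_norm.comp hc))) fun a => ?_
  simp only [Completion.norm_coe, completion_inner_coe]
  exact CStarModule.norm_eq_sqrt_norm_inner_self a

/-- The completion of a pre-Hilbert C⋆-module is a Hilbert C⋆-module, the inner product and the
action being extended by continuity. -/
instance completionCStarModule : CStarModule R (Completion E) where
  inner_add_right {x y z} := by
    refine Completion.induction_on₃ x y z (isClosed_eq
      (completion_inner_cont R E (by fun_prop) (by fun_prop))
      (.add (completion_inner_cont R E (by fun_prop) (by fun_prop)) (completion_inner_cont R E (by fun_prop) (by fun_prop)))) fun a b c => ?_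
    rw [← Completion.coe_add]
    simp only [completion_inner_coe, CStarModule.inner_add_right]
  inner_self_nonneg {x} := by
    refine Completion.induction_on x
      (CStarAlgebra.isClosed_nonneg.preimage (completion_inner_cont R E continuous_id continuous_id)) fun a => ?_
    change 0 ≤ ⟪(a : Completion E), (a : Completion E)⟫_R
    rw [completion_inner_coe]
    exact CStarModule.inner_self_nonneg
  inner_self {x} := by
    rw [← norm_eq_zero (a := x), completion_norm_eq R, Real.sqrt_eq_zero (norm_nonneg _),
      norm_eq_zero]
  inner_op_smul_right {a x y} := by
    have hu := CStarModule.uniformContinuousConstSMul R E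
    have hs : Continuous fun y : Completion E => a • y := Completion.continuous_map
    refine Completion.induction_on₂ x y (isClosed_eq
      (completion_inner_cont R E continuous_fst (hs.comp continuous_snd))
      (.mul continuous_const (completion_inner_cont R E continuous_fst continuous_snd))) fun b c => ?_
    rw [← Completion.coe_smul]
    simp only [completion_inner_coe, CStarModule.inner_op_smul_right]
  inner_smul_right_complex {a x y} := by
    refine Completion.induction_on₂ x y (isClosed_eq
      (completion_inner_cont R E continuous_fst (continuous_snd.const_smul a))
      (.const_smul (completion_inner_cont R E continuous_fst continuous_snd) a)) fun b c => ?_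
    rw [← Completion.coe_smul]
    simp only [completion_inner_coe, CStarModule.inner_smul_right_complex]
  star_inner x y := by
    refine Completion.induction_on₂ x y (isClosed_eq
      (.star (completion_inner_cont R E continuous_fst continuous_snd)) (completion_inner_cont R E continuous_snd continuous_fst)) fun b c => ?_
    simp only [completion_inner_coe, CStarModule.star_inner]
  norm_eq_sqrt_norm_inner_self x := completion_norm_eq R x

variable (R E) in
/-- The algebra of adjointable operators on a Hilbert C⋆-module `E` over `R`: the operators `T`
for which there is an operator `S` with `⟪T x, y⟫ = ⟪x, S y⟫` for all `x, y`. -/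
def adjointable : Subalgebra ℂ (E →L[ℂ] E) where
  carrier := {T | ∃ S : E →L[ℂ] E, ∀ x y : E, ⟪T x, y⟫_R = ⟪x, S y⟫_R}
  mul_mem' := by
    rintro T T' ⟨S, hS⟩ ⟨S', hS'⟩
    exact ⟨S' * S, fun x y => by simp [hS, hS']⟩
  add_mem' := by
    rintro T T' ⟨S, hS⟩ ⟨S', hS'⟩
    exact ⟨S + S', fun x y => by simp [hS, hS']⟩
  algebraMap_mem' c := ⟨algebraMap ℂ _ (star c), fun x y => by
    simp [Algebra.algebraMap_eq_smul_one]⟩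

variable (R E) in
/-- The C⋆-algebra of adjointable operators on `E`, with the operator norm. -/
def Adjointable : Type _ := adjointable R E

namespace Adjointable

instance : NormedRing (Adjointable R E) := inferInstanceAs (NormedRing (adjointable R E))

instance : NormedAlgebra ℂ (Adjointable R E) :=
  inferInstanceAs (NormedAlgebra ℂ (adjointable R E))

/-- The underlying bounded operator of an adjointable operator. -/
def toCLM (T : Adjointable R E) : E →L[ℂ] E := Subtype.val (p := (· ∈ adjointable R E)) T

theorem toCLM_injective : Function.Injective (toCLM (R := R) (E := E)) := Subtype.val_injective

@[simp] theorem toCLM_add (T S : Adjointable R E) : (T + S).toCLM = T.toCLM + S.toCLM := rfl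
@[simp] theorem toCLM_mul (T S : Adjointable R E) : (T * S).toCLM = T.toCLM * S.toCLM := rfl
@[simp] theorem toCLM_smul (c : ℂ) (T : Adjointable R E) : (c • T).toCLM = c • T.toCLM := rfl
theorem norm_toCLM (T : Adjointable R E) : ‖T.toCLM‖ = ‖T‖ := rfl

/-- The adjoint of an adjointable operator. -/
instance : Star (Adjointable R E) where
  star T := ⟨T.2.choose, T.toCLM, fun x y => by
    rw [← CStarModule.star_inner, ← T.2.choose_spec, CStarModule.star_inner]; rfl⟩

theorem inner_left (T : Adjointable R E) (x y : E) :
    ⟪T.toCLM x, y⟫_R = ⟪x, (star T).toCLM y⟫_R :=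
  T.2.choose_spec x y

theorem eq_star_of_inner {T S : Adjointable R E}
    (h : ∀ x y : E, ⟪T.toCLM x, y⟫_R = ⟪x, S.toCLM y⟫_R) : S = star T := by
  apply toCLM_injective
  ext y
  exact CStarModule.ext_inner_right (R := R) fun x => by rw [← h, inner_left]

theorem inner_right (T : Adjointable R E) (x y : E) :
    ⟪x, T.toCLM y⟫_R = ⟪(star T).toCLM x, y⟫_R := by
  rw [← CStarModule.star_inner, inner_left, CStarModule.star_inner]

instance : StarRing (Adjointable R E) where
  star_involutive T := (eq_star_of_inner fun x y => (inner_right T x y).symm).symm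
  star_mul T S := (eq_star_of_inner fun x y => by simp [inner_left]).symm
  star_add T S := (eq_star_of_inner fun x y => by simp [inner_left]).symm

instance : StarModule ℂ (Adjointable R E) where
  star_smul c T := (eq_star_of_inner fun x y => by simp [inner_left]).symm

instance : CStarRing (Adjointable R E) where
  norm_mul_self_le T := by
    have h : ∀ x : E, ‖T.toCLM x‖ ≤ √‖star T * T‖ * ‖x‖ := fun x => by
      refine abs_le_of_sq_le_sq' ?_ (by positivity) |>.2
      rw [CStarModule.norm_sq_eq R, inner_left, mul_pow, Real.sq_sqrt (norm_nonneg _), sq]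
      calc _ ≤ ‖x‖ * ‖(star T * T).toCLM x‖ := CStarModule.norm_inner_le E
        _ ≤ ‖x‖ * (‖star T * T‖ * ‖x‖) := by
          gcongr; exact (star T * T).toCLM.le_opNorm x
        _ = _ := by ring
    have h' := T.toCLM.opNorm_le_bound (Real.sqrt_nonneg _) h
    calc ‖T‖ * ‖T‖ ≤ √‖star T * T‖ * √‖star T * T‖ := by
          gcongr <;> exact h'
      _ = _ := Real.mul_self_sqrt (norm_nonneg _)

instance [CompleteSpace E] : CompleteSpace (Adjointable R E) := by
  refine Metric.complete_of_cauchySeq_tendsto fun u hu => ?_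
  have hu' : CauchySeq fun n => star (u n) := by
    rw [Metric.cauchySeq_iff] at hu ⊢
    intro ε hε
    obtain ⟨N, hN⟩ := hu ε hε
    refine ⟨N, fun m hm n hn => ?_⟩
    rw [dist_eq_norm, ← star_sub, norm_star, ← dist_eq_norm]
    exact hN m hm n hn
  obtain ⟨T, hT⟩ := cauchySeq_tendsto_of_complete
    (u := fun n => (u n).toCLM) (uniformContinuous_subtype_val.comp_cauchySeq hu)
  obtain ⟨S, hS⟩ := cauchySeq_tendsto_of_complete
    (u := fun n => (star (u n)).toCLM) (uniformContinuous_subtype_val.comp_cauchySeq hu')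
  have key : ∀ x y : E, ⟪T x, y⟫_R = ⟪x, S y⟫_R := fun x y => by
    have h1 : Filter.Tendsto (fun n => ⟪(u n).toCLM x, y⟫_R) Filter.atTop (nhds ⟪T x, y⟫_R) :=
      ((CStarModule.continuous_inner (A := R) (E := E)).tendsto (T x, y)).comp
        (((ContinuousLinearMap.apply ℂ E x).continuous.tendsto T |>.comp hT).prodMk_nhds
          tendsto_const_nhds)
    have h2 : Filter.Tendsto (fun n => ⟪x, (star (u n)).toCLM y⟫_R) Filter.atTop
        (nhds ⟪x, S y⟫_R) :=
      ((CStarModule.continuous_inner (A := R) (E := E)).tendsto (x, S y)).comp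
        (tendsto_const_nhds.prodMk_nhds
          ((ContinuousLinearMap.apply ℂ E y).continuous.tendsto S |>.comp hS))
    exact tendsto_nhds_unique h1 (by simpa only [inner_left] using h2)
  exact ⟨⟨T, S, key⟩, tendsto_subtype_rng.2 hT⟩

instance [CompleteSpace E] : CStarAlgebra (Adjointable R E) where

end Adjointable

end HilbertModule

/-! ### Fell bundles -/

/-- A Fell bundle over a discrete group `G`. To avoid transports between the fibers over equal
group elements, the product of the fibers over `g` and `h` is given as a map into the fiber over
any `k` together with a proof of `g * h = k`, and similarly for the involution. -/
structure FellBundle (G : Type u) [Group G] where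
  /-- The fibers, which are complex Banach spaces. -/
  fiber : G → Type w
  [normedAddCommGroup : ∀ g, NormedAddCommGroup (fiber g)]
  [normedSpace : ∀ g, NormedSpace ℂ (fiber g)]
  [completeSpace : ∀ g, CompleteSpace (fiber g)]
  /-- The bilinear product `A_g × A_h → A_{gh}`. -/
  mul : ∀ {g h k : G}, g * h = k → fiber g →ₗ[ℂ] fiber h →ₗ[ℂ] fiber k
  /-- The conjugate-linear involution `A_g → A_{g⁻¹}`. -/
  adj : ∀ {g k : G}, g⁻¹ = k → fiber g →ₗ⋆[ℂ] fiber k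
  mul_assoc : ∀ {g₁ g₂ g₃ g₁₂ g₂₃ g₁₂₃ : G} (h₁₂ : g₁ * g₂ = g₁₂) (h₂₃ : g₂ * g₃ = g₂₃)
    (h : g₁₂ * g₃ = g₁₂₃) (h' : g₁ * g₂₃ = g₁₂₃) (a : fiber g₁) (b : fiber g₂) (c : fiber g₃),
    mul h (mul h₁₂ a b) c = mul h' a (mul h₂₃ b c)
  norm_mul_le : ∀ {g h k : G} (e : g * h = k) (a : fiber g) (b : fiber h),
    ‖mul e a b‖ ≤ ‖a‖ * ‖b‖
  adj_adj : ∀ {g k : G} (e : g⁻¹ = k) (e' : k⁻¹ = g) (a : fiber g), adj e' (adj e a) = a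
  adj_mul : ∀ {g h k g' h' k' : G} (e : g * h = k) (eg : g⁻¹ = g') (eh : h⁻¹ = h')
    (ek : k⁻¹ = k') (e' : h' * g' = k') (a : fiber g) (b : fiber h),
    adj ek (mul e a b) = mul e' (adj eh b) (adj eg a)
  norm_adj : ∀ {g k : G} (e : g⁻¹ = k) (a : fiber g), ‖adj e a‖ = ‖a‖
  norm_adj_mul_self : ∀ {g k : G} (e : g⁻¹ = k) (e' : k * g = 1) (a : fiber g),
    ‖mul e' (adj e a) a‖ = ‖a‖ ^ 2
  /-- `a⋆ a` is a positive element of the C⋆-algebra `A_e`, i.e. of the form `c⋆ c` with `c` in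
  `A_e`. -/
  adj_mul_self_pos : ∀ {g k : G} (e : g⁻¹ = k) (e' : k * g = 1) (a : fiber g),
    ∃ c : fiber 1, mul e' (adj e a) a = mul (one_mul 1) (adj inv_one c) c

attribute [instance] FellBundle.normedAddCommGroup FellBundle.normedSpace
  FellBundle.completeSpace

namespace FellBundle

variable {G : Type u} [Group G] (A : FellBundle.{u, w} G)

/-- The unit fiber is a C⋆-algebra. -/
instance unitFiberCStarAlgebra : NonUnitalCStarAlgebra (A.fiber 1) where
  __ := A.normedAddCommGroup 1
  __ := A.normedSpace 1
  __ := A.completeSpace 1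
  mul a b := A.mul (one_mul 1) a b
  star a := A.adj inv_one a
  left_distrib a b c := map_add (A.mul (one_mul 1) a) b c
  right_distrib a b c := LinearMap.map_add₂ (A.mul (one_mul 1)) a b c
  zero_mul a := LinearMap.map_zero₂ (A.mul (one_mul 1)) a
  mul_zero a := map_zero (A.mul (one_mul 1) a)
  mul_assoc a b c := A.mul_assoc _ _ _ _ a b c
  norm_mul_le a b := A.norm_mul_le (one_mul 1) a b
  star_involutive a := A.adj_adj _ _ a
  star_mul a b := A.adj_mul _ _ _ _ _ a b
  star_add a b := map_add (A.adj inv_one) a b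
  norm_mul_self_le a := by
    rw [← sq]; exact (A.norm_adj_mul_self inv_one (one_mul 1) a).ge
  smul_assoc c a b := LinearMap.map_smul₂ (A.mul (one_mul 1)) c a b
  smul_comm c a b := (map_smul (A.mul (one_mul 1) a) c b).symm
  star_smul c a := map_smulₛₗ (A.adj inv_one) c a

/-- The order of the C⋆-algebra `A_e`: `x ≤ y` when `y - x` is positive. -/
instance : PartialOrder (A.fiber 1) := CStarAlgebra.spectralOrder _

instance : StarOrderedRing (A.fiber 1) := CStarAlgebra.spectralOrderedRing _

theorem mul_def (a b : A.fiber 1) : a * b = A.mul (one_mul 1) a b := rfl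

theorem star_def (a : A.fiber 1) : star a = A.adj inv_one a := rfl

variable {A}

theorem adj_mul_self_nonneg {g k : G} (e : g⁻¹ = k) (e' : k * g = 1) (a : A.fiber g) :
    0 ≤ A.mul e' (A.adj e a) a := by
  obtain ⟨c, hc⟩ := A.adj_mul_self_pos e e' a
  rw [hc]
  exact star_mul_self_nonneg c

/-- For `x ≥ 0` in `A_e` and `c` in any fiber, `c⋆ x c ≤ ‖x‖ c⋆ c`. -/
theorem adj_mul_mul_le {g k : G} (e : g⁻¹ = k) (e' : k * g = 1) {x : A.fiber 1} (hx : 0 ≤ x)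
    (c : A.fiber g) :
    A.mul e' (A.adj e c) (A.mul (one_mul g) x c) ≤ ‖x‖ • A.mul e' (A.adj e c) c := by
  have hx' : 0 ≤ algebraMap ℝ (Unitization ℂ (A.fiber 1)) ‖x‖ - (x : Unitization ℂ (A.fiber 1)) := by
    rw [sub_nonneg, ← Unitization.norm_inr (𝕜 := ℂ) x]
    exact IsSelfAdjoint.le_algebraMap_norm_self
      (.of_nonneg (Unitization.inr_nonneg_iff.2 hx))
  obtain ⟨y, hy⟩ := CStarAlgebra.nonneg_iff_eq_star_mul_self.1 hx'
  have h1 : (‖x‖ : ℂ) = star y.fst * y.fst := by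
    simpa [Algebra.algebraMap_eq_smul_one] using congrArg (fun z => z.fst) (sub_eq_iff_eq_add.1 hy)
  have h2 : -x = star y.fst • y.snd + y.fst • star y.snd + star y.snd * y.snd := by
    have := congrArg (fun z => z.snd) (sub_eq_iff_eq_add.1 hy)
    rw [neg_eq_iff_add_eq_zero, add_comm]
    simpa [Algebra.algebraMap_eq_smul_one] using this.symm
  have h3 := adj_mul_self_nonneg e e' (y.fst • c + A.mul (one_mul g) y.snd c)
  rw [← sub_nonneg]
  convert h3 using 1
  have hk : k * 1 = k := mul_one k
  have e1 : A.adj e (A.mul (one_mul g) y.snd c) = A.mul hk (A.adj e c) (star y.snd) :=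
    A.adj_mul _ _ _ _ _ _ _
  have e2 : A.mul e' (A.mul hk (A.adj e c) (star y.snd)) (A.mul (one_mul g) y.snd c)
      = A.mul e' (A.adj e c) (A.mul (one_mul g) (star y.snd * y.snd) c) := by
    rw [A.mul_assoc hk (one_mul g) e' e', mul_def, A.mul_assoc (one_mul 1) (one_mul g)]
  have e3 : A.mul e' (A.mul hk (A.adj e c) (star y.snd)) c
      = A.mul e' (A.adj e c) (A.mul (one_mul g) (star y.snd) c) := by
    rw [A.mul_assoc hk (one_mul g) e' e']
  have e4 : A.mul e' (A.adj e c) (A.mul (one_mul g) x c) =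
      -A.mul e' (A.adj e c) (A.mul (one_mul g) (-x) c) := by simp
  rw [e4, h2]
  have e5 : ‖x‖ • A.mul e' (A.adj e c) c = (‖x‖ : ℂ) • A.mul e' (A.adj e c) c := by
    simp
  rw [e5, h1]
  simp only [map_add, LinearMap.add_apply, map_smul, LinearMap.smul_apply, e1, e2, e3,
    LinearMap.map_smulₛₗ, smul_add, smul_smul]
  simp only [starRingEnd_apply, mul_comm]
  abel

variable (A)

/-- The space `C_c(A)` of finitely supported sections of `A`. -/
def Cc : Type _ := Π₀ g, A.fiber g

instance : AddCommGroup A.Cc := inferInstanceAs (AddCommGroup (Π₀ g, A.fiber g))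

instance : Module ℂ A.Cc := inferInstanceAs (Module ℂ (Π₀ g, A.fiber g))

instance : DFunLike A.Cc G A.fiber := inferInstanceAs (DFunLike (Π₀ g, A.fiber g) G A.fiber)

variable {A}

namespace Cc

@[ext] theorem ext {f f' : A.Cc} (h : ∀ g, f g = f' g) : f = f' := DFunLike.ext _ _ h

@[simp] theorem add_apply (f f' : A.Cc) (g : G) : (f + f') g = f g + f' g := rfl

@[simp] theorem zero_apply (g : G) : (0 : A.Cc) g = 0 := rfl

@[simp] theorem smul_apply (c : ℂ) (f : A.Cc) (g : G) : (c • f) g = c • f g := rfl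

theorem exists_finset (f : A.Cc) : ∃ s : Finset G, ∀ g ∉ s, f g = 0 := by
  classical
  exact ⟨DFinsupp.support f, fun g hg => DFinsupp.notMem_support_iff.1 hg⟩

/-- A section which vanishes outside a finite set. -/
def mk (f : ∀ g, A.fiber g) (h : ∃ s : Finset G, ∀ g ∉ s, f g = 0) : A.Cc :=
  DFinsupp.mk' f (Trunc.mk ⟨h.choose.val, fun g => or_iff_not_imp_left.2 (h.choose_spec g)⟩)

@[simp] theorem mk_apply (f : ∀ g, A.fiber g) (h) (g : G) : mk f h g = f g := rfl

/-- The canonical injection `j_g` of the fiber over `g` into `C_c(A)`. -/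
def single (g : G) : A.fiber g →ₗ[ℂ] A.Cc := by
  classical exact DFinsupp.lsingle g

/-- The linear map on `C_c(A)` given by linear maps on the fibers: `f ↦ ∑ g, L g (f g)`. -/
def sumMap {V : Type*} [AddCommGroup V] [Module ℂ V] (L : ∀ g, A.fiber g →ₗ[ℂ] V) :
    A.Cc →ₗ[ℂ] V := by
  classical exact DFinsupp.lsum ℂ L

@[simp] theorem sumMap_single {V : Type*} [AddCommGroup V] [Module ℂ V]
    (L : ∀ g, A.fiber g →ₗ[ℂ] V) (g : G) (a : A.fiber g) : sumMap L (single g a) = L g a := by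
  classical exact DFinsupp.lsum_single (S := ℂ) L g a

theorem induction {motive : A.Cc → Prop} (f : A.Cc) (zero : motive 0)
    (single : ∀ g a, motive (single g a))
    (add : ∀ f f', motive f → motive f' → motive (f + f')) : motive f := by
  classical
  exact DFinsupp.induction f zero fun g a f' _ _ hf => add _ _ (single g a) hf

/-- The right action of the unit fiber on `C_c(A)`, `(f a)(h) = f(h) a`. -/
instance : SMul (A.fiber 1)ᵐᵒᵖ A.Cc where
  smul a f := mk (fun h => A.mul (mul_one h) (f h) a.unop) <| by
    obtain ⟨s, hs⟩ := f.exists_finset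
    exact ⟨s, fun g hg => by simp [hs g hg]⟩

theorem op_smul_apply (a : (A.fiber 1)ᵐᵒᵖ) (f : A.Cc) (h : G) :
    (a • f) h = A.mul (mul_one h) (f h) a.unop := rfl

/-- The `A_e`-valued inner product `∑ h, f₁(h)⋆ f₂(h)`. Mathlib's `CStarModule R E` requires
`⟪x, r • y⟫ = r * ⟪x, y⟫`, so a right Hilbert module over `A_e` is a `CStarModule` over the
opposite algebra of `A_e`. -/
instance : Inner (A.fiber 1)ᵐᵒᵖ A.Cc where
  inner f₁ f₂ := op (∑ᶠ h : G, A.mul (inv_mul_cancel h) (A.adj rfl (f₁ h)) (f₂ h))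

theorem inner_eq_sum (f₁ f₂ : A.Cc) (s : Finset G) (hs : ∀ g ∉ s, f₂ g = 0) :
    ⟪f₁, f₂⟫_(A.fiber 1)ᵐᵒᵖ =
      op (∑ h ∈ s, A.mul (inv_mul_cancel h) (A.adj rfl (f₁ h)) (f₂ h)) := by
  refine congrArg op (finsum_eq_sum_of_support_subset _ fun h hh => ?_)
  by_contra hc
  exact hh (by simp [hs h hc])

theorem exists_finset₂ (f f' : A.Cc) : ∃ s : Finset G, ∀ g ∉ s, f g = 0 ∧ f' g = 0 := by
  classical
  obtain ⟨s, hs⟩ := f.exists_finset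
  obtain ⟨t, ht⟩ := f'.exists_finset
  exact ⟨s ∪ t, fun g hg => by
    rw [Finset.mem_union, not_or] at hg; exact ⟨hs g hg.1, ht g hg.2⟩⟩

instance : Norm A.Cc := CStarModule.norm (A.fiber 1)ᵐᵒᵖ

instance : CStarModule (A.fiber 1)ᵐᵒᵖ A.Cc where
  inner_add_right {x y z} := by
    obtain ⟨s, hs⟩ := exists_finset₂ y z
    rw [inner_eq_sum x (y + z) s fun g hg => by simp [hs g hg],
      inner_eq_sum x y s fun g hg => (hs g hg).1, inner_eq_sum x z s fun g hg => (hs g hg).2]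
    simp [Finset.sum_add_distrib]
  inner_self_nonneg {x} := by
    obtain ⟨s, hs⟩ := exists_finset x
    rw [inner_eq_sum x x s hs]
    exact Finset.sum_nonneg (N := A.fiber 1) fun h _ => adj_mul_self_nonneg _ _ _
  inner_self {x} := by
    obtain ⟨s, hs⟩ := exists_finset x
    rw [inner_eq_sum x x s hs, op_eq_zero_iff,
      Finset.sum_eq_zero_iff_of_nonneg fun h _ => adj_mul_self_nonneg _ _ _]
    constructor
    · intro h
      ext g
      by_cases hg : g ∈ s
      · have := A.norm_adj_mul_self rfl (inv_mul_cancel g) (x g)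
        rw [h g hg, norm_zero] at this
        simpa using this.symm
      · simp [hs g hg]
    · rintro rfl
      simp
  inner_op_smul_right {a x y} := by
    obtain ⟨s, hs⟩ := exists_finset y
    rw [inner_eq_sum x (a • y) s fun g hg => by simp [hs g hg, op_smul_apply],
      inner_eq_sum x y s hs]
    apply unop_injective
    simp only [unop_op, unop_mul, Finset.sum_mul, op_smul_apply]
    refine Finset.sum_congr rfl fun h _ => ?_
    rw [mul_def, A.mul_assoc]
  inner_smul_right_complex {c x y} := by
    obtain ⟨s, hs⟩ := exists_finset y
    rw [inner_eq_sum x (c • y) s fun g hg => by simp [hs g hg], inner_eq_sum x y s hs]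
    simp [Finset.smul_sum]
  star_inner x y := by
    obtain ⟨s, hs⟩ := exists_finset₂ x y
    rw [inner_eq_sum x y s fun g hg => (hs g hg).2, inner_eq_sum y x s fun g hg => (hs g hg).1]
    apply unop_injective
    simp only [unop_op, unop_star, star_sum]
    refine Finset.sum_congr rfl fun h _ => ?_
    rw [star_def, A.adj_mul (inv_mul_cancel h) (inv_inv h) rfl inv_one (inv_mul_cancel h),
      A.adj_adj]
  norm_eq_sqrt_norm_inner_self x := rfl

instance : NormedAddCommGroup A.Cc := CStarModule.normedAddCommGroup (A.fiber 1)ᵐᵒᵖ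

instance : NormedSpace ℂ A.Cc := .ofCore (CStarModule.normedSpaceCore (A.fiber 1)ᵐᵒᵖ)

/-- The operator `(λ_g(a) f)(h) = a f(g⁻¹ h)` on `C_c(A)`. -/
def translate {g : G} (a : A.fiber g) : A.Cc →ₗ[ℂ] A.Cc where
  toFun f := mk (fun h => A.mul (mul_inv_cancel_left g h) a (f (g⁻¹ * h))) <| by
    classical
    obtain ⟨s, hs⟩ := f.exists_finset
    refine ⟨s.image (g * ·), fun h hh => ?_⟩
    rw [hs, map_zero]
    exact fun hm => hh (Finset.mem_image.2 ⟨_, hm, mul_inv_cancel_left g h⟩)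
  map_add' f f' := by ext; simp
  map_smul' c f := by ext; simp

@[simp] theorem translate_apply {g : G} (a : A.fiber g) (f : A.Cc) (h : G) :
    translate a f h = A.mul (mul_inv_cancel_left g h) a (f (g⁻¹ * h)) := rfl

theorem translate_apply' {g h k : G} (e : g * k = h) (a : A.fiber g) (f : A.Cc) :
    translate a f h = A.mul e a (f k) := by
  obtain rfl : k = g⁻¹ * h := by rw [← e, inv_mul_cancel_left]
  rfl

theorem inner_translate_left {g k : G} (e : g⁻¹ = k) (a : A.fiber g) (f f' : A.Cc) :
    ⟪translate a f, f'⟫_(A.fiber 1)ᵐᵒᵖ = ⟪f, translate (A.adj e a) f'⟫_(A.fiber 1)ᵐᵒᵖ := by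
  subst e
  refine congrArg op ?_
  refine (finsum_comp_equiv (Equiv.mulLeft g)).symm.trans (finsum_congr fun x => ?_)
  change A.mul (inv_mul_cancel (g * x)) (A.adj rfl (translate a f (g * x))) (f' (g * x)) = _
  rw [translate_apply' (g := g) (k := x) rfl, translate_apply' (inv_mul_cancel_left g x),
    A.adj_mul rfl rfl rfl rfl (mul_inv_rev g x).symm, A.mul_assoc]

theorem translate_adj_translate {g : G} (a : A.fiber g) (f : A.Cc) (x : G) :
    translate (A.adj rfl a) (translate a f) x =
      A.mul (one_mul x) (A.mul (inv_mul_cancel g) (A.adj rfl a) a) (f x) := by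
  rw [translate_apply' (inv_mul_cancel_left g x), translate_apply' (g := g) (k := x) rfl,
    A.mul_assoc]

theorem norm_translate_le {g : G} (a : A.fiber g) (f : A.Cc) :
    ‖translate a f‖ ≤ ‖a‖ * ‖f‖ := by
  refine abs_le_of_sq_le_sq' ?_ (by positivity) |>.2
  obtain ⟨s, hs⟩ := exists_finset f
  rw [mul_pow, CStarModule.norm_sq_eq (A.fiber 1)ᵐᵒᵖ,
    CStarModule.norm_sq_eq (A.fiber 1)ᵐᵒᵖ (x := f), inner_translate_left rfl,
    inner_eq_sum f f s hs,
    inner_eq_sum f _ s fun x hx => by rw [translate_adj_translate, hs x hx, map_zero],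
    norm_op, norm_op, ← A.norm_adj_mul_self rfl (inv_mul_cancel g) a, ← norm_norm (A.mul _ _ a),
    ← norm_smul, Finset.smul_sum]
  have key : ∀ x : G, A.mul (inv_mul_cancel x) (A.adj rfl (f x))
      (translate (A.adj rfl a) (translate a f) x) ≤
      ‖A.mul (inv_mul_cancel g) (A.adj rfl a) a‖ •
        A.mul (inv_mul_cancel x) (A.adj rfl (f x)) (f x) := fun x => by
    rw [translate_adj_translate]
    exact adj_mul_mul_le _ _ (adj_mul_self_nonneg _ _ a) (f x)
  refine CStarAlgebra.norm_le_norm_of_nonneg_of_le ?_ (Finset.sum_le_sum fun x _ => key x)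
  have h0 : 0 ≤ ⟪translate a f, translate a f⟫_(A.fiber 1)ᵐᵒᵖ :=
    CStarModule.inner_self_nonneg (A := (A.fiber 1)ᵐᵒᵖ) (E := A.Cc)
  rw [inner_translate_left rfl,
    inner_eq_sum f _ s fun x hx => by rw [translate_adj_translate, hs x hx, map_zero]] at h0
  exact h0

end Cc

variable (A)

/-- The right Hilbert `A_e`-module `ℓ²(A)`, the completion of `C_c(A)`. -/
abbrev L2 : Type _ := Completion A.Cc

/-- The C⋆-algebra of adjointable operators on `ℓ²(A)`. -/
abbrev AdjL2 : Type _ := Adjointable (A.fiber 1)ᵐᵒᵖ A.L2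

variable {A}

/-- `λ_g(a)` as a bounded operator on `ℓ²(A)`, the extension of `Cc.translate a`. -/
def regCLM {g : G} (a : A.fiber g) : A.L2 →L[ℂ] A.L2 :=
  ((Cc.translate a).mkContinuous ‖a‖ (Cc.norm_translate_le a)).completion

theorem regCLM_coe {g : G} (a : A.fiber g) (f : A.Cc) :
    regCLM a (f : A.L2) = (Cc.translate a f : A.L2) :=
  ContinuousLinearMap.completion_apply_coe _ f

theorem inner_regCLM_left {g k : G} (e : g⁻¹ = k) (a : A.fiber g) (x y : A.L2) :
    ⟪regCLM a x, y⟫_(A.fiber 1)ᵐᵒᵖ = ⟪x, regCLM (A.adj e a) y⟫_(A.fiber 1)ᵐᵒᵖ := by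
  refine Completion.induction_on₂ x y (isClosed_eq
    (completion_inner_cont _ _ ((regCLM a).continuous.comp continuous_fst) continuous_snd)
    (completion_inner_cont _ _ continuous_fst ((regCLM _).continuous.comp continuous_snd)))
    fun f f' => ?_
  rw [regCLM_coe, regCLM_coe, completion_inner_coe, completion_inner_coe,
    Cc.inner_translate_left e]

theorem regCLM_ext {T S : A.L2 →L[ℂ] A.L2} (h : ∀ f : A.Cc, T f = S f) : T = S := by
  ext x
  exact Completion.induction_on x (isClosed_eq T.continuous S.continuous) h

variable (A) in
/-- The left regular representation `λ_g : A_g → L(ℓ²(A))`. -/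
def reg (g : G) : A.fiber g →ₗ[ℂ] A.AdjL2 where
  toFun a := ⟨regCLM a, regCLM (A.adj rfl a), inner_regCLM_left rfl a⟩
  map_add' a b := Adjointable.toCLM_injective <| regCLM_ext fun f => by
    change regCLM (a + b) f = regCLM a f + regCLM b f
    rw [regCLM_coe, regCLM_coe, regCLM_coe, ← Completion.coe_add]
    congr 1
    ext; simp
  map_smul' c a := Adjointable.toCLM_injective <| regCLM_ext fun f => by
    change regCLM (c • a) f = c • regCLM a f
    rw [regCLM_coe, regCLM_coe, ← Completion.coe_smul]
    congr 1
    ext; simp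

theorem toCLM_reg {g : G} (a : A.fiber g) : (A.reg g a).toCLM = regCLM a := rfl

/-- The defining formula of the regular representation: `(λ_g(a) f)(h) = a f(g⁻¹ h)`. -/
theorem reg_coe {g : G} (a : A.fiber g) (f : A.Cc) :
    (A.reg g a).toCLM (f : A.L2) = (Cc.translate a f : A.L2) := regCLM_coe a f

theorem reg_star {g k : G} (e : g⁻¹ = k) (a : A.fiber g) :
    star (A.reg g a) = A.reg k (A.adj e a) := by
  symm
  apply Adjointable.eq_star_of_inner
  intro x y
  rw [toCLM_reg, toCLM_reg]
  exact inner_regCLM_left e a x y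

theorem reg_mul {g h k : G} (e : g * h = k) (a : A.fiber g) (b : A.fiber h) :
    A.reg g a * A.reg h b = A.reg k (A.mul e a b) :=
  Adjointable.toCLM_injective <| regCLM_ext fun f => by
    change regCLM a (regCLM b f) = regCLM (A.mul e a b) f
    rw [regCLM_coe, regCLM_coe, regCLM_coe]
    congr 1
    ext x
    have e1 : g * (g⁻¹ * x) = x := mul_inv_cancel_left g x
    have e2 : h * (h⁻¹ * (g⁻¹ * x)) = g⁻¹ * x := mul_inv_cancel_left h _
    have e3 : k * (h⁻¹ * (g⁻¹ * x)) = x := by rw [← e]; group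
    rw [Cc.translate_apply' e1, Cc.translate_apply' e2, Cc.translate_apply' e3,
      A.mul_assoc e e2 e3 e1]

variable (A) in
/-- The reduced cross-sectional C⋆-algebra `C_r⋆(A)`: the closed ⋆-subalgebra of `L(ℓ²(A))`
generated by the operators `λ_g(a)`. -/
def reducedSubalgebra : NonUnitalStarSubalgebra ℂ A.AdjL2 :=
  (NonUnitalStarAlgebra.adjoin ℂ {x | ∃ (g : G) (a : A.fiber g), A.reg g a = x}).topologicalClosure

variable (A) in
/-- The type of elements of `C_r⋆(A)`. -/
def Cr : Type _ := A.reducedSubalgebra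

instance : NonUnitalCStarAlgebra A.Cr :=
  NonUnitalStarSubalgebra.nonUnitalCStarAlgebra A.reducedSubalgebra
    (h_closed := NonUnitalStarSubalgebra.isClosed_topologicalClosure _)

instance : PartialOrder A.Cr := CStarAlgebra.spectralOrder _

instance : StarOrderedRing A.Cr := CStarAlgebra.spectralOrderedRing _

variable (A) in
/-- `λ_g` as a map into `C_r⋆(A)`. -/
def lam (g : G) : A.fiber g →ₗ[ℂ] A.Cr where
  toFun a := ⟨A.reg g a, NonUnitalStarSubalgebra.le_topologicalClosure _
    (NonUnitalStarAlgebra.subset_adjoin ℂ _ ⟨g, a, rfl⟩)⟩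
  map_add' a b := Subtype.ext (map_add (A.reg g) a b)
  map_smul' c a := Subtype.ext (map_smul (A.reg g) c a)

theorem lam_star {g k : G} (e : g⁻¹ = k) (a : A.fiber g) :
    star (A.lam g a) = A.lam k (A.adj e a) := Subtype.ext (reg_star e a)

theorem lam_mul {g h k : G} (e : g * h = k) (a : A.fiber g) (b : A.fiber h) :
    A.lam g a * A.lam h b = A.lam k (A.mul e a b) := Subtype.ext (reg_mul e a b)

variable (A) in
/-- The map `ι : C_c(A) → C_r⋆(A)`, `ι(f) = ∑ g, λ_g(f(g))`. The reduced norm of `f` is `‖ι(f)‖`. -/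
def iota : A.Cc →ₗ[ℂ] A.Cr := Cc.sumMap A.lam

@[simp] theorem iota_single (g : G) (a : A.fiber g) : A.iota (Cc.single g a) = A.lam g a :=
  Cc.sumMap_single _ _ _

theorem iota_mul_mem (f f' : A.Cc) : A.iota f * A.iota f' ∈ LinearMap.range A.iota := by
  induction f using Cc.induction with
  | zero => rw [map_zero, zero_mul]; exact zero_mem _
  | add f₁ f₂ h₁ h₂ => rw [map_add, add_mul]; exact add_mem h₁ h₂
  | single g a =>
    induction f' using Cc.induction with
    | zero => rw [map_zero, mul_zero]; exact zero_mem _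
    | add f₁ f₂ h₁ h₂ => rw [map_add, mul_add]; exact add_mem h₁ h₂
    | single h b =>
      rw [iota_single, iota_single, lam_mul rfl, ← iota_single]
      exact ⟨_, rfl⟩

theorem iota_star_mem (f : A.Cc) : star (A.iota f) ∈ LinearMap.range A.iota := by
  induction f using Cc.induction with
  | zero => rw [map_zero, star_zero]; exact zero_mem _
  | add f₁ f₂ h₁ h₂ => rw [map_add, star_add]; exact add_mem h₁ h₂
  | single g a =>
    rw [iota_single, lam_star rfl, ← iota_single]
    exact ⟨_, rfl⟩

theorem mem_range_iota {x : A.AdjL2}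
    (hx : x ∈ NonUnitalStarAlgebra.adjoin ℂ {x | ∃ (g : G) (a : A.fiber g), A.reg g a = x}) :
    ∃ f : A.Cc, (Subtype.val (p := (· ∈ A.reducedSubalgebra)) (A.iota f)) = x := by
  induction hx using NonUnitalStarAlgebra.adjoin_induction with
  | mem x hx =>
    obtain ⟨g, a, rfl⟩ := hx
    exact ⟨Cc.single g a, congrArg Subtype.val (iota_single g a)⟩
  | add x y _ _ h₁ h₂ =>
    obtain ⟨f, rfl⟩ := h₁
    obtain ⟨f', rfl⟩ := h₂
    exact ⟨f + f', congrArg Subtype.val (map_add A.iota f f')⟩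
  | zero => exact ⟨0, congrArg Subtype.val (map_zero A.iota)⟩
  | mul x y _ _ h₁ h₂ =>
    obtain ⟨f, rfl⟩ := h₁
    obtain ⟨f', rfl⟩ := h₂
    obtain ⟨f'', h⟩ := iota_mul_mem f f'
    exact ⟨f'', congrArg Subtype.val h⟩
  | smul c x _ h =>
    obtain ⟨f, rfl⟩ := h
    exact ⟨c • f, congrArg Subtype.val (map_smul A.iota c f)⟩
  | star x _ h =>
    obtain ⟨f, rfl⟩ := h
    obtain ⟨f'', h⟩ := iota_star_mem f
    exact ⟨f'', congrArg Subtype.val h⟩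

variable (A) in
theorem denseRange_iota : DenseRange A.iota := by
  have h : Topology.IsInducing (Subtype.val : A.reducedSubalgebra → A.AdjL2) :=
    Topology.IsInducing.subtypeVal
  intro x
  rw [show closure (Set.range A.iota) = _ from h.closure_eq_preimage_closure_image _]
  refine closure_mono (fun y hy => ?_) x.2
  obtain ⟨f, hf⟩ := mem_range_iota hy
  exact ⟨A.iota f, ⟨f, rfl⟩, hf⟩

end FellBundle

/-! ### Bundle maps -/

/-- A bundle map between Fell bundles over `G` and `H` along a homomorphism `φ : G → H`: a family
of bounded linear maps from the fiber over `g` to the fiber over `φ g`. -/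
abbrev BundleMap {G : Type u} {H : Type v} [Group G] [Group H] (A : FellBundle.{u, w} G)
    (φ : G →* H) (B : FellBundle.{v, w'} H) : Type _ :=
  ∀ g : G, A.fiber g →L[ℂ] B.fiber (φ g)

namespace BundleMap

variable {G : Type u} {H : Type v} [Group G] [Group H] {A : FellBundle.{u, w} G} {φ : G →* H}
  {B : FellBundle.{v, w'} H}

/-- Positive definiteness: `∑ i j, b_i T_{g_i⁻¹ g_j}(a_i⋆ a_j) b_j⋆ ≥ 0` in `B_e` for all finite
families `g_i ∈ G`, `a_i ∈ A_{g_i}`, `b_i ∈ B_{φ(g_i)}`. -/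
def IsPositiveDefinite (T : BundleMap A φ B) : Prop :=
  ∀ (n : ℕ) (g : Fin n → G) (a : ∀ i, A.fiber (g i)) (b : ∀ i, B.fiber (φ (g i))),
    0 ≤ ∑ i, ∑ j,
      B.mul (k := 1) (mul_inv_cancel (φ (g j)))
        (B.mul (k := φ (g j)) (by simp) (b i)
          (T ((g i)⁻¹ * g j) (A.mul rfl (A.adj rfl (a i)) (a j))))
        (B.adj rfl (b j))

/-- The linear map `φ_T : C_c(A) → C_c(B)` with `φ_T(j_g(a)) = j_{φ(g)}(T_g(a))`. -/
def sectionMap (T : BundleMap A φ B) : A.Cc →ₗ[ℂ] B.Cc :=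
  FellBundle.Cc.sumMap fun g => FellBundle.Cc.single (φ g) ∘ₗ (T g).toLinearMap

/-- `T` is reduced when `φ_T` is bounded for the reduced norms on `C_c(A)` and `C_c(B)`. -/
def IsReduced (T : BundleMap A φ B) : Prop :=
  ∃ C : ℝ, ∀ f : A.Cc, ‖B.iota (T.sectionMap f)‖ ≤ C * ‖A.iota f‖

/-- The map `M_T : C_r⋆(A) → C_r⋆(B)`: for a reduced `T`, the bounded extension of `φ_T`. -/
def reducedMap (T : BundleMap A φ B) (_hT : T.IsReduced) : A.Cr →L[ℂ] B.Cr :=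
  (B.iota ∘ₗ T.sectionMap).extendOfNorm A.iota

theorem reducedMap_iota (T : BundleMap A φ B) (hT : T.IsReduced) (f : A.Cc) :
    T.reducedMap hT (A.iota f) = B.iota (T.sectionMap f) :=
  LinearMap.extendOfNorm_eq (f := B.iota ∘ₗ T.sectionMap) A.denseRange_iota hT f

theorem reducedMap_lam (T : BundleMap A φ B) (hT : T.IsReduced) (g : G) (a : A.fiber g) :
    T.reducedMap hT (A.lam g a) = B.lam (φ g) (T g a) := by
  rw [← FellBundle.iota_single, reducedMap_iota]
  simp [sectionMap]

/-- `T` is reduced precisely when there is a bounded linear map `M : C_r⋆(A) → C_r⋆(B)` with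
`M(λ_g(a)) = λ_{φ(g)}(T_g(a))`. -/
theorem isReduced_iff (T : BundleMap A φ B) :
    T.IsReduced ↔
      ∃ M : A.Cr →L[ℂ] B.Cr, ∀ (g : G) (a : A.fiber g), M (A.lam g a) = B.lam (φ g) (T g a) := by
  refine ⟨fun hT => ⟨T.reducedMap hT, T.reducedMap_lam hT⟩, ?_⟩
  rintro ⟨M, hM⟩
  have h : ∀ f : A.Cc, B.iota (T.sectionMap f) = M (A.iota f) := fun f => by
    induction f using FellBundle.Cc.induction with
    | zero => simp only [map_zero]
    | single g a => simp [sectionMap, hM]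
    | add f₁ f₂ h₁ h₂ => simp only [map_add, h₁, h₂]
  exact ⟨‖M‖, fun f => by rw [h]; exact M.le_opNorm _⟩

/-- The map `M_T` is the only bounded linear map with `M(λ_g(a)) = λ_{φ(g)}(T_g(a))`. -/
theorem reducedMap_unique (T : BundleMap A φ B) (hT : T.IsReduced) (M : A.Cr →L[ℂ] B.Cr)
    (hM : ∀ (g : G) (a : A.fiber g), M (A.lam g a) = B.lam (φ g) (T g a)) :
    M = T.reducedMap hT := by
  refine ContinuousLinearMap.coeFn_injective (A.denseRange_iota.equalizer M.continuous
    (T.reducedMap hT).continuous (funext fun f => ?_))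
  induction f using FellBundle.Cc.induction with
  | zero => simp only [Function.comp_apply, map_zero]
  | single g a => simp [hM, reducedMap_lam]
  | add f₁ f₂ h₁ h₂ =>
    simp only [Function.comp_apply, map_add] at h₁ h₂ ⊢
    rw [h₁, h₂]

end BundleMap

/-- A bounded linear map between C⋆-algebras is completely positive. -/
def IsCompletelyPositive {R S : Type*} [NonUnitalCStarAlgebra R] [PartialOrder R]
    [StarOrderedRing R] [NonUnitalCStarAlgebra S] [PartialOrder S] [StarOrderedRing S]
    (M : R →L[ℂ] S) : Prop :=
  ∃ Ψ : R →CP S, ∀ x : R, Ψ x = M x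

/-- A discrete group is amenable when there is a left-invariant mean on the space `ℓ^∞(K)` of
bounded real functions. -/
def IsAmenableGroup (K : Type*) [Group K] : Prop :=
  ∃ m : lp (fun _ : K => ℝ) ⊤ →ₗ[ℝ] ℝ,
    (∀ f, (∀ x, 0 ≤ f x) → 0 ≤ m f) ∧
    (∀ f, (∀ x, f x = 1) → m f = 1) ∧
    ∀ (k : K) (f f' : lp (fun _ : K => ℝ) ⊤), (∀ x, f' x = f (k * x)) → m f' = m f

end

/-! Everything is computed inside the reduced C⋆-algebras. Coefficients of a section are dominated
by its reduced norm (`norm_apply_le_norm_iota`), so the fibers embed isometrically. The family `T`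
becomes a linear map `T.lin` on the dense ⋆-subalgebra `A.algCr` before any boundedness is known,
and positivity in `B_e` can be tested in `B.Cr`.

Positivity of the form ⟪ξ_i, T(F_i⋆ F_j) ξ_j⟫ on ℓ²(B). The definition only tests coefficients c_i =
b_i⋆ of degree φ(g_i)⁻¹, while the form needs degree φ(g_i)⁻¹ k for every k. If k = φ(g_l), a soft
projection f built from x_l x_l⋆ splits x_i⋆ x_j as y_i⋆ y_j + x'_i⋆ x'_j. Here y_i = x_l⋆ w x_i has
the degree that the definition allows, and x'_i = (1 - f) x_i with x'_l almost zero, so that l can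
be removed by induction. A general k reduces to these by compression (`nonneg_of_conj_homog`). This
is `IsPositiveDefinite.sum_nonneg`.

Boundedness, where amenability enters. Multiplying `T` by a finitely supported coefficient function
of the regular representation keeps it positive and makes it bounded, with an uncontrolled constant.
The self-improving estimate `norm_map_conj_le`, a repeated Cauchy–Schwarz argument, replaces that
constant by one depending only on the value at the unit. Amenability of the kernel lets such
functions tend to the indicator of ker φ, so the part of `T` over the kernel satisfies the same
bound. A vector of ℓ²(B) living in one fiber sees only that part. Finite sums of such vectors then
have some bound, which the self-improving estimate sharpens again to ‖T_e‖ ‖v‖² ‖ξ‖². Cauchy–Schwarz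
and an approximate unit of A_e yield ‖T.lin F‖ ≤ ‖T_e‖ ‖F‖, and restricting to the copy of A_e shows
that the constant is attained.

Complete positivity is then the positivity of the form above, extended by continuity. Conversely,
the matrix (λ(a_i)⋆ λ(a_j)) is positive; applying M_T entrywise and compressing by the λ(b_i)⋆ gives
positive definiteness. -/

noncomputable section

open UniformSpace MulOpposite Filter Topology
open scoped ComplexOrder InnerProductSpace CStarAlgebra

/-! ### Positive elements of C⋆-algebras -/

section CStarLemmas

variable {R : Type*} [NonUnitalCStarAlgebra R] [PartialOrder R] [StarOrderedRing R]

/-- The negative part `n` of a selfadjoint element `z`, together with its square root `r`. -/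
theorem IsSelfAdjoint.exists_negPart_sqrt {z : R} (hz : IsSelfAdjoint z) :
    ∃ n r : R, star r = r ∧ r * r = n ∧ star n = n ∧ n * z = -(n * n) ∧ (n = 0 → 0 ≤ z) := by
  obtain ⟨r, hr, hr'⟩ := CStarAlgebra.nonneg_iff_exists_isSelfAdjoint_and_eq_mul_self.1
    (CFC.negPart_nonneg z)
  refine ⟨z⁻, r, hr, hr'.symm, (CFC.negPart_nonneg z).isSelfAdjoint, ?_,
    (CFC.negPart_eq_zero_iff z hz).1⟩
  have h : z⁻ * (z⁺ - z⁻) = -(z⁻ * z⁻) := by rw [mul_sub, CFC.negPart_mul_posPart, zero_sub]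
  rwa [CFC.posPart_sub_negPart z hz] at h

theorem eq_zero_of_mul_self_eq_zero' {R : Type*} [NonUnitalCStarAlgebra R] {n : R}
    (hn : star n = n) (h : n * n = 0) : n = 0 := by
  rw [← CStarRing.star_mul_self_eq_zero_iff, hn, h]

theorem eq_zero_of_cube_eq_zero {R : Type*} [NonUnitalCStarAlgebra R] {n : R}
    (hn : star n = n) (h : n * n * n = 0) : n = 0 := by
  refine eq_zero_of_mul_self_eq_zero' hn (eq_zero_of_mul_self_eq_zero' (by simp [hn]) ?_)
  rw [← mul_assoc, h, zero_mul]

/-- An isometric (more generally, injective) `⋆`-preserving multiplicative linear map between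
C⋆-algebras reflects positivity. -/
theorem nonneg_of_map_nonneg {R S : Type*} [NonUnitalCStarAlgebra R] [PartialOrder R]
    [StarOrderedRing R] [NonUnitalCStarAlgebra S] [PartialOrder S] [StarOrderedRing S]
    (L : R →ₗ[ℂ] S) (hmul : ∀ x y, L (x * y) = L x * L y) (hstar : ∀ x, L (star x) = star (L x))
    (hinj : Function.Injective L) {z : R} (hz : 0 ≤ L z) : 0 ≤ z := by
  have hsa : IsSelfAdjoint z := hinj ((hstar z).trans (IsSelfAdjoint.of_nonneg hz))
  obtain ⟨n, r, hr, hrn, hn, hnz, h0⟩ := hsa.exists_negPart_sqrt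
  -- Both n z n = -n³ and (r n)⋆ (r n) = n³ are sent to positive elements, so L (n³) = 0.
  refine h0 (eq_zero_of_cube_eq_zero hn (hinj ?_))
  have h1 : 0 ≤ L n * L z * L n := by
    have := star_left_conjugate_nonneg hz (L n)
    rwa [← hstar, hn] at this
  have h2 : 0 ≤ L n * L n * L n := by
    have := star_mul_self_nonneg (L (r * n))
    rw [← hstar, star_mul, hr, hn, ← hmul, ← mul_assoc, mul_assoc n r r, hrn] at this
    rwa [← hmul, ← hmul]
  rw [← hmul, hnz, map_neg, neg_mul, hmul] at h1
  rw [map_zero, hmul, hmul]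
  exact le_antisymm (neg_nonneg.1 h1) h2

/-- For a positive `x` there is a soft projection `f` in the C⋆-algebra generated by `x` which
almost absorbs `x`, and such that `1 - (1 - f)²` factors through `x`. -/
theorem exists_soft_projection {x : R} (hx : 0 ≤ x) {ε : ℝ} (hε : 0 < ε) :
    ∃ f w : R, star f = f ∧ star w = w ∧ ‖f‖ ≤ 1 ∧ f + f - f * f = w * x * w ∧
      ‖x - f * x - x * f + f * x * f‖ ≤ ε := by
  have hsa : IsSelfAdjoint x := hx.isSelfAdjoint
  -- With the functions below, 1 - (1 - F)² = t W² and (1 - F)² t = t δ² / (δ + t²)². For δ = ε² the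
  -- latter is at most ε, because t ε ≤ δ + t².
  set δ : ℝ := ε ^ 2 with hδ
  have hδ0 : 0 < δ := by positivity
  have hspec : ∀ t ∈ quasispectrum ℝ x, 0 ≤ t := fun t ht => quasispectrum_nonneg_of_nonneg x hx t ht
  let F : ℝ → ℝ := fun t => t ^ 2 / (δ + t ^ 2)
  let W : ℝ → ℝ := fun t => √(t ^ 3 + 2 * δ * t) / (δ + t ^ 2)
  have hd : ∀ t : ℝ, δ + t ^ 2 ≠ 0 := fun t => by positivity
  have hF : Continuous F := by fun_prop (disch := exact hd _)
  have hW : Continuous W := by fun_prop (disch := exact hd _)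
  have hF0 : F 0 = 0 := by simp [F]
  have hW0 : W 0 = 0 := by simp [W]
  have hid : Continuous (fun t : ℝ => t) := continuous_id
  have eFx : cfcₙ (fun t => F t * t) x = cfcₙ F x * x := by
    rw [cfcₙ_mul F (fun t => t) x, cfcₙ_id' ℝ x]
  have exF : cfcₙ (fun t => t * F t) x = x * cfcₙ F x := by
    rw [cfcₙ_mul (fun t => t) F x, cfcₙ_id' ℝ x]
  refine ⟨cfcₙ F x, cfcₙ W x, cfcₙ_predicate F x, cfcₙ_predicate W x, ?_, ?_, ?_⟩
  · refine norm_cfcₙ_le fun t _ => ?_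
    have : 0 ≤ F t := by positivity
    rw [Real.norm_of_nonneg this, div_le_one (by positivity)]
    linarith
  · have e2 : cfcₙ (fun t => W t * t * W t) x = cfcₙ W x * x * cfcₙ W x := by
      rw [cfcₙ_mul (fun t => W t * t) W x, cfcₙ_mul W (fun t => t) x, cfcₙ_id' ℝ x]
    have e3 : cfcₙ (fun t => F t + F t - F t * F t) x =
        cfcₙ F x + cfcₙ F x - cfcₙ F x * cfcₙ F x := by
      rw [cfcₙ_sub (fun t => F t + F t) (fun t => F t * F t) x, cfcₙ_add F F x, cfcₙ_mul F F x]
    rw [← e2, ← e3]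
    refine cfcₙ_congr fun t ht => ?_
    have h0 := hspec t ht
    have hs : √(t ^ 3 + 2 * δ * t) * √(t ^ 3 + 2 * δ * t) = t ^ 3 + 2 * δ * t :=
      Real.mul_self_sqrt (by positivity)
    have h1 : W t * t * W t = t * (t ^ 3 + 2 * δ * t) / (δ + t ^ 2) ^ 2 := by
      simp only [W]
      rw [div_mul_eq_mul_div, div_mul_div_comm, mul_right_comm, hs, ← sq, mul_comm _ t]
    simp only [h1]
    simp only [F]
    field_simp
    ring
  · have e4 : cfcₙ (fun t => t - F t * t - t * F t + F t * t * F t) x =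
        x - cfcₙ F x * x - x * cfcₙ F x + cfcₙ F x * x * cfcₙ F x := by
      rw [cfcₙ_add (fun t => t - F t * t - t * F t) (fun t => F t * t * F t) x,
        cfcₙ_sub (fun t => t - F t * t) (fun t => t * F t) x,
        cfcₙ_sub (fun t => t) (fun t => F t * t) x, cfcₙ_mul (fun t => F t * t) F x, eFx, exF,
        cfcₙ_id' ℝ x]
    rw [← e4]
    refine norm_cfcₙ_le fun t ht => ?_
    have h0 := hspec t ht
    have h1 : t - F t * t - t * F t + F t * t * F t = t * δ ^ 2 / (δ + t ^ 2) ^ 2 := by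
      simp only [F]
      field_simp
      ring
    rw [h1, Real.norm_of_nonneg (by positivity), div_le_iff₀ (by positivity)]
    have h2 : t * ε ≤ δ + t ^ 2 := by rw [hδ]; nlinarith [sq_nonneg (t - ε)]
    calc t * δ ^ 2 = ε * ((t * ε) * δ) := by rw [hδ]; ring
      _ ≤ ε * ((δ + t ^ 2) * (δ + t ^ 2)) := by gcongr; nlinarith
      _ = _ := by ring

/-- A real quadratic polynomial that is nonnegative everywhere has nonpositive discriminant. -/
theorem sq_le_mul_of_forall_two_mul_le {p a b : ℝ} (h : ∀ t : ℝ, 2 * t * p ≤ a + t ^ 2 * b) :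
    p ^ 2 ≤ a * b := by
  have := discrim_le_zero (a := b) (b := -(2 * p)) (c := a) fun t => by nlinarith [h t]
  rw [discrim] at this
  nlinarith

/-- If `0 ≤ a - 2 t p + t² b` for all real `t`, with `p ≥ 0`, then `‖p‖² ≤ ‖a‖ ‖b‖`. -/
theorem norm_sq_le_of_forall_nonneg {a b p : R} (hp : 0 ≤ p)
    (h : ∀ t : ℝ, 0 ≤ a - (2 * t) • p + t ^ 2 • b) : ‖p‖ ^ 2 ≤ ‖a‖ * ‖b‖ := by
  refine sq_le_mul_of_forall_two_mul_le fun t => ?_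
  rcases le_or_gt t 0 with ht | ht
  · have := mul_nonneg_of_nonpos_of_nonpos ht (neg_nonpos.2 (norm_nonneg p))
    have : 0 ≤ ‖a‖ + t ^ 2 * ‖b‖ := by positivity
    nlinarith
  · have h1 : (2 * t) • p ≤ a + t ^ 2 • b := by
      rw [← sub_nonneg]
      convert h t using 1
      abel
    have h2 := CStarAlgebra.norm_le_norm_of_nonneg_of_le
      (smul_nonneg (by positivity : 0 ≤ 2 * t) hp) h1
    rw [norm_smul, Real.norm_of_nonneg (by positivity : 0 ≤ 2 * t)] at h2
    refine h2.trans ((norm_add_le _ _).trans ?_)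
    rw [norm_smul, Real.norm_of_nonneg (by positivity)]

/-- A self-improving estimate: a positive linear map `L` on a dense `⋆`-subalgebra for which
`F ↦ ‖L (v⋆ F⋆ F v)‖` is bounded by some multiple of `‖F‖²` is bounded by `‖L (v⋆ v)‖ ‖F‖²`. -/
theorem norm_map_conj_le {S : Type*} [NonUnitalCStarAlgebra S]
    (𝒜 : NonUnitalStarSubalgebra ℂ S) (L : S →ₗ[ℂ] R) (hL : ∀ y ∈ 𝒜, 0 ≤ L (star y * y))
    {v : S} (hv : v ∈ 𝒜) {C : ℝ}
    (hC : ∀ F ∈ 𝒜, ‖L (star (F * v) * (F * v))‖ ≤ C * ‖F‖ ^ 2) {F : S} (hF : F ∈ 𝒜) :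
    ‖L (star (F * v) * (F * v))‖ ≤ ‖L (star v * v)‖ * ‖F‖ ^ 2 := by
  set N := ‖L (star v * v)‖ with hN
  -- Cauchy–Schwarz for the form (x, y) ↦ L (x⋆ y) at the pair v, F⋆ F v; the element v plays the
  -- role of a missing unit.
  have key : ∀ F ∈ 𝒜, ‖L (star (F * v) * (F * v))‖ ^ 2 ≤
      N * ‖L (star (star F * F * v) * (star F * F * v))‖ := fun F hF => by
    refine norm_sq_le_of_forall_nonneg (hL _ (mul_mem hF hv)) fun t => ?_
    have h := hL (v - (t : ℂ) • (star F * F * v))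
      (sub_mem hv (SMulMemClass.smul_mem _ (mul_mem (mul_mem (star_mem hF) hF) hv)))
    convert h using 1
    have e1 : star v * (star F * F * v) = star (F * v) * (F * v) := by simp [mul_assoc]
    have e2 : star (star F * F * v) * v = star (F * v) * (F * v) := by simp [mul_assoc]
    simp only [star_sub, sub_mul, mul_sub, star_smul, smul_mul_assoc, mul_smul_comm, e1, e2,
      map_sub, map_smul, ← Complex.coe_smul (_ : ℝ) (_ : R), RCLike.star_def,
      Complex.conj_ofReal]
    push_cast
    module
  -- The admissible constants form a closed nonempty set bounded below, so a smallest one exists.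
  let 𝒞 : Set ℝ := {c | 0 ≤ c ∧ ∀ F ∈ 𝒜, ‖L (star (F * v) * (F * v))‖ ≤ c * ‖F‖ ^ 2}
  have hne : 𝒞.Nonempty := ⟨max C 0, le_max_right _ _, fun F hF => (hC F hF).trans (by
    gcongr; exact le_max_left _ _)⟩
  have hcl : IsClosed 𝒞 := by
    simp only [𝒞, Set.ofPred_and, Set.ofPred_forall]
    exact isClosed_Ici.inter (isClosed_iInter fun F => isClosed_iInter fun _ =>
      isClosed_le continuous_const (by fun_prop))
  have hbdd : BddBelow 𝒞 := ⟨0, fun c hc => hc.1⟩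
  have hmem := hcl.csInf_mem hne hbdd
  set c := sInf 𝒞 with hc
  -- Feeding the best constant c into the right side of `key`, with ‖F⋆ F‖ = ‖F‖², shows that √(N c)
  -- is admissible. Minimality then forces c ≤ √(N c), that is c ≤ N.
  have hstep : √(N * c) ∈ 𝒞 := by
    refine ⟨Real.sqrt_nonneg _, fun F hF => ?_⟩
    refine abs_le_of_sq_le_sq' ?_ (by positivity) |>.2
    have h1 := hmem.2 (star F * F) (mul_mem (star_mem hF) hF)
    have h2 := hmem.1
    rw [mul_pow, Real.sq_sqrt (by positivity)]
    calc _ ≤ N * (c * ‖star F * F‖ ^ 2) := (key F hF).trans (by gcongr)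
      _ = _ := by rw [CStarRing.norm_star_mul_self]; ring
  have hle : c ≤ √(N * c) := csInf_le hbdd hstep
  have hcN : c ≤ N := by
    have h0 := hmem.1
    rw [Real.le_sqrt h0 (by positivity)] at hle
    rcases h0.eq_or_lt with h | h
    · rw [← h]; positivity
    · nlinarith
  exact (hmem.2 F hF).trans (by gcongr)

end CStarLemmas

namespace FellBundle

variable {G : Type u} [Group G] {A : FellBundle.{u, w} G}

/-! ### Sections and the action of the reduced C⋆-algebra -/

namespace Cc

@[simp] theorem single_same (g : G) (a : A.fiber g) : single g a g = a := by
  classical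
  exact DFinsupp.single_eq_same

theorem single_of_ne {g h : G} (hne : h ≠ g) (a : A.fiber g) : single g a h = 0 := by
  classical
  exact DFinsupp.single_eq_of_ne hne

theorem eq_sum_single (f : A.Cc) (s : Finset G) (hs : ∀ g ∉ s, f g = 0) :
    f = ∑ g ∈ s, single g (f g) := by
  classical
  have hcoe : ∀ (t : Finset G) (h : G), (∑ g ∈ t, single g (f g)) h = if h ∈ t then f h else 0 := by
    intro t h
    induction t using Finset.induction_on with
    | empty => simp
    | insert g t hg ih =>
      rw [Finset.sum_insert hg, add_apply, ih]
      by_cases hh : h = g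
      · subst hh; simp [hg]
      · simp [single_of_ne hh, hh]
  ext h
  rw [hcoe]
  split_ifs with hh
  · rfl
  · exact hs h hh

theorem norm_apply_le (f : A.Cc) (g : G) : ‖f g‖ ≤ ‖f‖ := by
  classical
  refine abs_le_of_sq_le_sq' ?_ (norm_nonneg _) |>.2
  obtain ⟨s, hs⟩ := exists_finset f
  rw [CStarModule.norm_sq_eq (A.fiber 1)ᵐᵒᵖ (x := f),
    inner_eq_sum f f (insert g s) (fun h hh => hs h fun h' => hh (Finset.mem_insert_of_mem h')),
    norm_op, ← A.norm_adj_mul_self rfl (inv_mul_cancel g) (f g)]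
  refine CStarAlgebra.norm_le_norm_of_nonneg_of_le (adj_mul_self_nonneg _ _ _) ?_
  exact Finset.single_le_sum (f := fun h => A.mul (inv_mul_cancel h) (A.adj rfl (f h)) (f h))
    (fun h _ => adj_mul_self_nonneg _ _ _) (Finset.mem_insert_self g s)

theorem norm_single (g : G) (a : A.fiber g) : ‖single g a‖ = ‖a‖ := by
  rw [← sq_eq_sq₀ (norm_nonneg _) (norm_nonneg _), CStarModule.norm_sq_eq (A.fiber 1)ᵐᵒᵖ,
    inner_eq_sum _ _ {g} (fun h hh => single_of_ne (by simpa using hh) a), norm_op]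
  simp [A.norm_adj_mul_self]

theorem translate_single {g h k : G} (e : g * h = k) (a : A.fiber g) (b : A.fiber h) :
    translate a (single h b) = single k (A.mul e a b) := by
  ext x
  by_cases hx : x = k
  · subst hx
    rw [translate_apply' e, single_same, single_same]
  · rw [single_of_ne hx, translate_apply, single_of_ne, map_zero]
    rintro rfl
    exact hx (by rw [← e, mul_inv_cancel_left])

end Cc

variable (A) in
/-- The action of `C_r⋆(A)` on `ℓ²(A)`. -/
def act : A.Cr →ₗᵢ[ℂ] (A.L2 →L[ℂ] A.L2) where
  toFun x := (Subtype.val (p := (· ∈ A.reducedSubalgebra)) x).toCLM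
  map_add' _ _ := rfl
  map_smul' _ _ := rfl
  norm_map' _ := rfl

@[simp] theorem act_mul (x y : A.Cr) (ξ : A.L2) : A.act (x * y) ξ = A.act x (A.act y ξ) := rfl

theorem inner_act_left (x : A.Cr) (ξ η : A.L2) :
    ⟪A.act x ξ, η⟫_(A.fiber 1)ᵐᵒᵖ = ⟪ξ, A.act (star x) η⟫_(A.fiber 1)ᵐᵒᵖ :=
  Adjointable.inner_left _ ξ η

theorem act_lam_coe {g : G} (a : A.fiber g) (f : A.Cc) :
    A.act (A.lam g a) (f : A.L2) = (Cc.translate a f : A.L2) := reg_coe a f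

theorem norm_act_apply_le (x : A.Cr) (ξ : A.L2) : ‖A.act x ξ‖ ≤ ‖x‖ * ‖ξ‖ := by
  rw [← A.act.norm_map x]
  exact (A.act x).le_opNorm ξ

/-- Vectors supported at the unit recover a section from the operator it defines, up to right
multiplication by b. -/
theorem act_iota_single (f : A.Cc) (b : A.fiber 1) :
    A.act (A.iota f) (Cc.single 1 b : A.Cc) =
      ((op b • f : A.Cc) : A.L2) := by
  induction f using Cc.induction with
  | zero =>
    rw [map_zero, map_zero, _root_.zero_apply, ← Completion.coe_zero]
    congr 1
    ext
    simp [Cc.op_smul_apply]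
  | add f₁ f₂ h₁ h₂ =>
    rw [map_add, map_add, _root_.add_apply, h₁, h₂, ← Completion.coe_add]
    congr 1
    ext
    simp [Cc.op_smul_apply]
  | single g a =>
    rw [iota_single, act_lam_coe, Cc.translate_single (mul_one g)]
    congr 1
    ext x
    rw [Cc.op_smul_apply]
    by_cases hx : x = g
    · subst hx; simp
    · simp [Cc.single_of_ne hx]

/-- The coefficients of an element of `C_r⋆(A)` are dominated by its norm. -/
theorem norm_apply_le_norm_iota (f : A.Cc) (g : G) : ‖f g‖ ≤ ‖A.iota f‖ := by
  rcases (norm_nonneg (f g)).eq_or_lt with h0 | h0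
  · rw [← h0]; exact norm_nonneg _
  -- Testing `A.iota f` on the vector y at the unit bounds ‖f(g) y‖ by ‖ι f‖ ‖y‖. As y² = f(g)⋆
  -- (f(g) y) and ‖y‖ = ‖f(g)‖², this bounds ‖f(g)‖⁴ by ‖f(g)‖³ ‖ι f‖.
  set y : A.fiber 1 := A.mul (inv_mul_cancel g) (A.adj rfl (f g)) (f g) with hy
  have hysa : star y = y := (IsSelfAdjoint.of_nonneg (adj_mul_self_nonneg _ _ _))
  have hyn : ‖y‖ = ‖f g‖ ^ 2 := A.norm_adj_mul_self _ _ _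
  have h1 : ‖A.mul (mul_one g) (f g) y‖ ≤ ‖A.iota f‖ * ‖y‖ := by
    have h2 := norm_act_apply_le (A.iota f) ((Cc.single 1 y : A.Cc) : A.L2)
    rw [act_iota_single, Completion.norm_coe, Completion.norm_coe, Cc.norm_single] at h2
    exact (Cc.norm_apply_le _ g).trans h2
  have h3 : ‖y‖ ^ 2 ≤ ‖f g‖ * ‖A.mul (mul_one g) (f g) y‖ := by
    have h4 : y * y = A.mul (inv_mul_cancel g) (A.adj rfl (f g)) (A.mul (mul_one g) (f g) y) := by
      rw [mul_def, ← A.mul_assoc (inv_mul_cancel g) (mul_one g) (one_mul 1)]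
    have h5 : ‖y * y‖ = ‖y‖ ^ 2 := by
      nth_rewrite 1 [← hysa]
      rw [CStarRing.norm_star_mul_self, sq]
    rw [← h5, h4]
    exact (FellBundle.norm_mul_le A _ _ _).trans (by rw [A.norm_adj])
  rw [hyn] at h1 h3
  have h6 : (‖f g‖ ^ 2) ^ 2 ≤ ‖f g‖ * (‖A.iota f‖ * ‖f g‖ ^ 2) := h3.trans (by gcongr)
  have h7 : ‖f g‖ ^ 3 * ‖f g‖ ≤ ‖f g‖ ^ 3 * ‖A.iota f‖ := by nlinarith
  exact le_of_mul_le_mul_left h7 (by positivity)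

/-- The upper bound is the norm of a translation operator; the lower bound is the coefficient
estimate at g. -/
theorem norm_lam (g : G) (a : A.fiber g) : ‖A.lam g a‖ = ‖a‖ := by
  apply le_antisymm
  · refine ContinuousLinearMap.opNorm_le_bound _ (norm_nonneg _) fun ξ => ?_
    refine Completion.induction_on ξ (isClosed_le (by fun_prop) (by fun_prop)) fun f => ?_
    rw [Completion.norm_coe]
    exact (congrArg norm (act_lam_coe a f)).trans_le
      ((Completion.norm_coe _).trans_le (Cc.norm_translate_le a f))
  · have := norm_apply_le_norm_iota (Cc.single g a) g
    rwa [Cc.single_same, iota_single] at this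

theorem lam_injective (g : G) : Function.Injective (A.lam g) := by
  rw [injective_iff_map_eq_zero]
  intro a ha
  rw [← norm_eq_zero, ← norm_lam, ha, norm_zero]

theorem lam_one_mul (a b : A.fiber 1) : A.lam 1 (a * b) = A.lam 1 a * A.lam 1 b :=
  (lam_mul (one_mul 1) a b).symm

theorem lam_one_star (a : A.fiber 1) : A.lam 1 (star a) = star (A.lam 1 a) :=
  (lam_star inv_one a).symm

/-- An isometric ⋆-homomorphism preserves and reflects positivity. Inequalities in the unit fiber
can thus be proved in the C⋆-algebra, where elements of all degrees multiply freely. -/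
theorem lam_one_nonneg_iff {a : A.fiber 1} : 0 ≤ A.lam 1 a ↔ 0 ≤ a := by
  refine ⟨nonneg_of_map_nonneg (A.lam 1) lam_one_mul lam_one_star (lam_injective 1), fun h => ?_⟩
  obtain ⟨b, rfl⟩ := CStarAlgebra.nonneg_iff_eq_star_mul_self.1 h
  rw [lam_one_mul, lam_one_star]
  exact star_mul_self_nonneg _

variable (A) in
theorem iota_injective : Function.Injective A.iota := by
  rw [injective_iff_map_eq_zero]
  intro f hf
  ext g
  have := norm_apply_le_norm_iota f g
  rw [hf, norm_zero] at this
  simpa using this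

/-! ### Homogeneous elements -/

variable (A) in
/-- The copy of the fiber over `g` in `C_r⋆(A)`. -/
def homog (g : G) : Submodule ℂ A.Cr := LinearMap.range (A.lam g)

theorem lam_mem_homog (g : G) (a : A.fiber g) : A.lam g a ∈ A.homog g := ⟨a, rfl⟩

theorem mul_mem_homog {g h k : G} (e : g * h = k) {x y : A.Cr} (hx : x ∈ A.homog g)
    (hy : y ∈ A.homog h) : x * y ∈ A.homog k := by
  obtain ⟨a, rfl⟩ := hx
  obtain ⟨b, rfl⟩ := hy
  exact ⟨_, (lam_mul e a b).symm⟩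

theorem star_mem_homog {g k : G} (e : g⁻¹ = k) {x : A.Cr} (hx : x ∈ A.homog g) :
    star x ∈ A.homog k := by
  obtain ⟨a, rfl⟩ := hx
  exact ⟨_, (lam_star e a).symm⟩

variable (A) in
/-- The dense `⋆`-subalgebra of `C_r⋆(A)` formed by the finite sums of homogeneous elements. -/
def algCr : NonUnitalStarSubalgebra ℂ A.Cr where
  __ := LinearMap.range A.iota
  mul_mem' := by
    rintro _ _ ⟨f, rfl⟩ ⟨f', rfl⟩
    exact iota_mul_mem f f'
  star_mem' := by
    rintro _ ⟨f, rfl⟩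
    exact iota_star_mem f

theorem iota_mem_algCr (f : A.Cc) : A.iota f ∈ A.algCr := ⟨f, rfl⟩

theorem exists_iota_eq {x : A.Cr} (hx : x ∈ A.algCr) : ∃ f, A.iota f = x := hx

theorem homog_le_algCr {g : G} {x : A.Cr} (hx : x ∈ A.homog g) : x ∈ A.algCr := by
  obtain ⟨a, rfl⟩ := hx
  exact ⟨Cc.single g a, iota_single g a⟩

theorem iota_eq_sum (f : A.Cc) (s : Finset G) (hs : ∀ g ∉ s, f g = 0) :
    A.iota f = ∑ g ∈ s, A.lam g (f g) := by
  conv_lhs => rw [Cc.eq_sum_single f s hs, map_sum]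
  simp

theorem exists_eq_sum_homog {x : A.Cr} (hx : x ∈ A.algCr) :
    ∃ (s : Finset G) (y : G → A.Cr), (∀ g, y g ∈ A.homog g) ∧ x = ∑ g ∈ s, y g := by
  obtain ⟨f, rfl⟩ := exists_iota_eq hx
  obtain ⟨s, hs⟩ := f.exists_finset
  exact ⟨s, fun g => A.lam g (f g), fun g => lam_mem_homog g _, iota_eq_sum f s hs⟩

variable (A) in
/-! ### The approximate unit -/

variable (A) in
/-- An approximate unit of `A_e`, as a filter. -/
def unitFilter : Filter (A.fiber 1) := CStarAlgebra.approximateUnit (A.fiber 1)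

instance : (A.unitFilter).NeBot := inferInstanceAs (CStarAlgebra.approximateUnit (A.fiber 1)).NeBot

variable (A) in
theorem unitFilter_spec : A.unitFilter.IsIncreasingApproximateUnit :=
  CStarAlgebra.increasingApproximateUnit (A.fiber 1)

theorem continuous_lam (g : G) : Continuous (A.lam g) :=
  (⟨A.lam g, norm_lam g⟩ : A.fiber g →ₗᵢ[ℂ] A.Cr).continuous

/-- Since x x⋆ = λ(z) with z in the unit fiber, ‖e x - x‖² = ‖(e x - x)(e x - x)⋆‖ ≤ 2 ‖e z - z‖
once ‖e‖ ≤ 1. -/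
theorem tendsto_unit_mul {g : G} {x : A.Cr} (hx : x ∈ A.homog g) :
    Tendsto (fun e => A.lam 1 e * x) A.unitFilter (𝓝 x) := by
  obtain ⟨z, hz⟩ := mul_mem_homog (mul_inv_cancel g) hx (star_mem_homog rfl hx)
  have h1 : Tendsto (fun e => A.lam 1 (e * z)) A.unitFilter (𝓝 (A.lam 1 z)) :=
    ((continuous_lam 1).tendsto z).comp (A.unitFilter_spec.tendsto_mul_right z)
  have hb : ∀ᶠ e in A.unitFilter, ‖A.lam 1 e * x - x‖ ^ 2 ≤ 2 * ‖A.lam 1 (e * z) - A.lam 1 z‖ := by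
    filter_upwards [A.unitFilter_spec.eventually_norm] with e he
    rw [sq, ← CStarRing.norm_self_mul_star]
    have e1 : (A.lam 1 e * x - x) * star (A.lam 1 e * x - x) =
        (A.lam 1 (e * z) - A.lam 1 z) * star (A.lam 1 e) - (A.lam 1 (e * z) - A.lam 1 z) := by
      rw [lam_one_mul, hz, star_sub, star_mul]
      noncomm_ring
    rw [e1]
    calc _ ≤ ‖A.lam 1 (e * z) - A.lam 1 z‖ * ‖star (A.lam 1 e)‖ + ‖A.lam 1 (e * z) - A.lam 1 z‖ :=
          (norm_sub_le _ _).trans (by gcongr; exact _root_.norm_mul_le _ _)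
      _ ≤ ‖A.lam 1 (e * z) - A.lam 1 z‖ * 1 + ‖A.lam 1 (e * z) - A.lam 1 z‖ := by
          rw [norm_star, norm_lam]; gcongr
      _ = _ := by ring
  have h2 : Tendsto (fun e => 2 * ‖A.lam 1 (e * z) - A.lam 1 z‖) A.unitFilter (𝓝 0) := by
    simpa using (tendsto_iff_norm_sub_tendsto_zero.1 h1).const_mul 2
  have h3 := squeeze_zero' (Eventually.of_forall fun e => sq_nonneg _) hb h2
  rw [tendsto_iff_norm_sub_tendsto_zero]
  simpa using h3.sqrt

theorem tendsto_mul_unit {g : G} {x : A.Cr} (hx : x ∈ A.homog g) :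
    Tendsto (fun e => x * A.lam 1 e) A.unitFilter (𝓝 x) := by
  have h := (tendsto_unit_mul (star_mem_homog rfl hx)).star
  rw [star_star] at h
  refine h.congr' ?_
  filter_upwards [A.unitFilter_spec.eventually_star_eq] with e he
  rw [star_mul, star_star, ← lam_one_star, he]

theorem tendsto_unit_mul_unit {g : G} {x : A.Cr} (hx : x ∈ A.homog g) :
    Tendsto (fun e => A.lam 1 e * x * A.lam 1 e) A.unitFilter (𝓝 x) := by
  have h1 := tendsto_unit_mul hx
  have h2 := tendsto_mul_unit hx
  rw [tendsto_iff_norm_sub_tendsto_zero] at h1 h2 ⊢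
  refine squeeze_zero' (Eventually.of_forall fun e => norm_nonneg _) ?_ (by simpa using h2.add h1)
  filter_upwards [A.unitFilter_spec.eventually_norm] with e he
  have : A.lam 1 e * x * A.lam 1 e - x = A.lam 1 e * (x * A.lam 1 e - x) + (A.lam 1 e * x - x) := by
    noncomm_ring
  rw [this]
  refine (norm_add_le _ _).trans ?_
  gcongr
  refine (_root_.norm_mul_le _ _).trans ?_
  rw [norm_lam]
  nlinarith [norm_nonneg (x * A.lam 1 e - x)]

end FellBundle

/-! ### The linear map on finite sums of homogeneous elements -/

namespace BundleMap

open FellBundle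

variable {G : Type u} {H : Type v} [Group G] [Group H] {A : FellBundle.{u, w} G} {φ : G →* H}
  {B : FellBundle.{v, w'} H}

/-- A linear map `C_r⋆(A) → C_r⋆(B)` which is `φ_T` on the finite sums of homogeneous elements.
Its values elsewhere are irrelevant. -/
def lin (T : BundleMap A φ B) : A.Cr →ₗ[ℂ] B.Cr :=
  B.iota ∘ₗ T.sectionMap ∘ₗ
    (A.iota.exists_leftInverse_of_injective (LinearMap.ker_eq_bot.2 A.iota_injective)).choose

theorem lin_iota (T : BundleMap A φ B) (f : A.Cc) : T.lin (A.iota f) = B.iota (T.sectionMap f) := by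
  have := LinearMap.congr_fun
    (A.iota.exists_leftInverse_of_injective (LinearMap.ker_eq_bot.2 A.iota_injective)).choose_spec f
  simp only [lin, LinearMap.comp_apply] at this ⊢
  rw [this, LinearMap.id_apply]

@[simp] theorem lin_lam (T : BundleMap A φ B) (g : G) (a : A.fiber g) :
    T.lin (A.lam g a) = B.lam (φ g) (T g a) := by
  rw [← iota_single, lin_iota]
  simp [sectionMap]

theorem lin_mem_homog (T : BundleMap A φ B) {g : G} {x : A.Cr} (hx : x ∈ A.homog g) :
    T.lin x ∈ B.homog (φ g) := by
  obtain ⟨a, rfl⟩ := hx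
  rw [lin_lam]
  exact lam_mem_homog _ _

theorem norm_lin_le (T : BundleMap A φ B) {g : G} {x : A.Cr} (hx : x ∈ A.homog g) :
    ‖T.lin x‖ ≤ ‖T g‖ * ‖x‖ := by
  obtain ⟨a, rfl⟩ := hx
  rw [lin_lam, norm_lam, norm_lam]
  exact (T g).le_opNorm a

/-- Continuity within a single fiber is all that is available before `T` is known to be reduced; it
suffices for approximate unit arguments. -/
theorem tendsto_lin (T : BundleMap A φ B) {g : G} {x : A.Cr} (hx : x ∈ A.homog g) {ι : Type*}
    {l : Filter ι} {y : ι → A.Cr} (hy : ∀ i, y i ∈ A.homog g) (h : Tendsto y l (𝓝 x)) :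
    Tendsto (fun i => T.lin (y i)) l (𝓝 (T.lin x)) := by
  rw [tendsto_iff_norm_sub_tendsto_zero] at h ⊢
  refine squeeze_zero (fun _ => norm_nonneg _) (fun i => ?_) (by simpa using h.const_mul ‖T g‖)
  rw [← map_sub]
  exact T.norm_lin_le (sub_mem (hy i) hx)

end BundleMap

/-! ### Consequences of positive definiteness -/

theorem nonneg_of_forall_approx {R : Type*} [NonUnitalCStarAlgebra R] [PartialOrder R]
    [StarOrderedRing R] {Z : R} (C : ℝ) (h : ∀ δ : ℝ, 0 < δ → ∃ r : R, ‖r‖ ≤ C * δ ∧ 0 ≤ Z - r) :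
    0 ≤ Z := by
  choose! r hr hr' using h
  have h1 : Tendsto (fun n : ℕ => Z - r (1 / ((n : ℝ) + 1))) atTop (𝓝 (Z - 0)) := by
    refine tendsto_const_nhds.sub (squeeze_zero_norm (fun n => hr _ (by positivity)) ?_)
    simpa using tendsto_one_div_add_atTop_nhds_zero_nat.const_mul C
  rw [sub_zero] at h1
  exact CStarAlgebra.isClosed_nonneg.mem_of_tendsto h1
    (Eventually.of_forall fun n => hr' _ (by positivity))

namespace FellBundle

variable {H : Type v} [Group H] {B : FellBundle.{v, w'} H}

/-- A selfadjoint element of the unit fiber of the form `∑ c_i⋆ t_i` is positive as soon as its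
compressions by all `d` in the fibers of the `c_i⋆` are. -/
theorem nonneg_of_conj_homog {Z : B.Cr} (hZ : Z ∈ B.homog 1) (hsa : star Z = Z) {ι : Type*}
    (s : Finset ι) (h : ι → H) (c t : ι → B.Cr) (hc : ∀ i ∈ s, c i ∈ B.homog (h i))
    (hsum : Z = ∑ i ∈ s, star (c i) * t i)
    (hd : ∀ i ∈ s, ∀ d ∈ B.homog (h i)⁻¹, 0 ≤ star d * Z * d) : 0 ≤ Z := by
  obtain ⟨z, rfl⟩ := hZ
  have hz : IsSelfAdjoint z := lam_injective 1 ((lam_one_star z).trans hsa)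
  obtain ⟨n, r, hr, hrn, hn, hnz, h0⟩ := hz.exists_negPart_sqrt
  refine lam_one_nonneg_iff.2 (h0 (lam_injective 1 ?_))
  rw [map_zero]
  set Z := B.lam 1 z
  set N := B.lam 1 n with hN
  set R := B.lam 1 r with hR
  have hR' : star R = R := by rw [hR, ← lam_one_star, hr]
  have hN' : star N = N := by rw [hN, ← lam_one_star, hn]
  have hRN : R * R = N := by rw [hR, ← lam_one_mul, hrn]
  have hNZ : N * Z = -(N * N) := by rw [hN, ← lam_one_mul, hnz, map_neg, lam_one_mul]
  -- Compressing Z by d = N c_i⋆ gives -(R N c_i⋆)⋆ (R N c_i⋆), which is positive only if R N c_i⋆ =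
  -- 0. Summing against t_i then yields N² Z = -N³ = 0.
  have key : ∀ i ∈ s, N * N * star (c i) = 0 := fun i hi => by
    have h1 := hd i hi (N * star (c i))
      (mul_mem_homog (one_mul _) (lam_mem_homog 1 n) (star_mem_homog rfl (hc i hi)))
    have e1 : star (N * star (c i)) * Z * (N * star (c i)) =
        -(star (R * N * star (c i)) * (R * N * star (c i))) := by
      simp only [star_mul, star_star, hR', hN']
      calc _ = c i * (N * Z) * N * star (c i) := by noncomm_ring
        _ = -(c i * N * (N) * N * star (c i)) := by rw [hNZ]; noncomm_ring
        _ = -(c i * N * (R * R) * N * star (c i)) := by rw [hRN]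
        _ = _ := by noncomm_ring
    rw [e1] at h1
    have h2 : R * N * star (c i) = 0 := CStarRing.star_mul_self_eq_zero_iff _ |>.1
      (le_antisymm (neg_nonneg.1 h1) (star_mul_self_nonneg _))
    calc N * N * star (c i) = R * (R * N * star (c i)) := by rw [← hRN]; noncomm_ring
      _ = 0 := by rw [h2, mul_zero]
  apply eq_zero_of_cube_eq_zero hN'
  have h3 : N * N * Z = 0 := by
    rw [hsum, Finset.mul_sum]
    exact Finset.sum_eq_zero fun i hi => by rw [← _root_.mul_assoc, key i hi, zero_mul]
  rw [_root_.mul_assoc, hNZ, mul_neg, neg_eq_zero, ← _root_.mul_assoc] at h3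
  exact h3

end FellBundle

namespace BundleMap

open FellBundle

variable {G : Type u} {H : Type v} [Group G] [Group H] {A : FellBundle.{u, w} G} {φ : G →* H}
  {B : FellBundle.{v, w'} H} {T : BundleMap A φ B}

/-- The sum in the definition of positive definiteness, computed in `C_r⋆(B)`. -/
theorem lam_one_sum_eq (T : BundleMap A φ B) (n : ℕ) (g : Fin n → G) (a : ∀ i, A.fiber (g i))
    (b : ∀ i, B.fiber (φ (g i))) :
    B.lam 1 (∑ i, ∑ j,
      B.mul (k := 1) (mul_inv_cancel (φ (g j)))
        (B.mul (k := φ (g j)) (by simp) (b i)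
          (T ((g i)⁻¹ * g j) (A.mul rfl (A.adj rfl (a i)) (a j))))
        (B.adj rfl (b j))) =
    ∑ i, ∑ j, B.lam _ (b i) * T.lin (star (A.lam _ (a i)) * A.lam _ (a j)) *
      star (B.lam _ (b j)) := by
  simp only [map_sum]
  refine Finset.sum_congr rfl fun i _ => Finset.sum_congr rfl fun j _ => ?_
  rw [lam_star rfl, lam_mul rfl, lin_lam, lam_star rfl, lam_mul (k := φ (g j)) (by simp),
    lam_mul (mul_inv_cancel (φ (g j)))]

/-- The definition transported to `B.Cr`, with c_i = b_i⋆ and an arbitrary finite index set. -/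
theorem IsPositiveDefinite.sum_nonneg_one (hT : T.IsPositiveDefinite) {ι : Type*} (s : Finset ι)
    (g : ι → G) (x : ι → A.Cr) (c : ι → B.Cr) (hx : ∀ i ∈ s, x i ∈ A.homog (g i))
    (hc : ∀ i ∈ s, c i ∈ B.homog (φ (g i))⁻¹) :
    0 ≤ ∑ i ∈ s, ∑ j ∈ s, star (c i) * T.lin (star (x i) * x j) * c j := by
  let e := s.equivFin.symm
  have hx' : ∀ i, ∃ a : A.fiber (g (e i)), A.lam _ a = x (e i) := fun i => hx _ (e i).2
  have hc' : ∀ i, ∃ b : B.fiber (φ (g (e i))), B.lam _ b = star (c (e i)) :=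
    fun i => star_mem_homog (inv_inv _) (hc _ (e i).2)
  choose a ha using hx'
  choose b hb using hc'
  have h := lam_one_nonneg_iff.2 (hT s.card (fun i => g (e i)) a b)
  rw [lam_one_sum_eq] at h
  simp only [ha, hb, star_star] at h
  rw [← Finset.sum_coe_sort s, ← e.sum_comp]
  refine h.trans_eq (Finset.sum_congr rfl fun i _ => ?_)
  rw [← Finset.sum_coe_sort s, ← e.sum_comp]

/-- A positive definite bundle map is hermitian. -/
theorem IsPositiveDefinite.lin_star (hT : T.IsPositiveDefinite) {g : G} {x : A.Cr}
    (hx : x ∈ A.homog g) : T.lin (star x) = star (T.lin x) := by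
  -- Without a unit, x itself need not be an entry x_i⋆ x_j with admissible degrees, but e x is the
  -- off-diagonal entry for the pair e⋆, x. An approximate unit removes e at the end.
  have step : ∀ e ∈ A.homog 1, T.lin (star (e * x)) = star (T.lin (e * x)) := fun e he => by
    have hex : e * x ∈ A.homog g := mul_mem_homog (one_mul g) he hx
    have hsa : ∀ c₁ ∈ B.homog 1, ∀ c₂ ∈ B.homog (φ g)⁻¹,
        IsSelfAdjoint (star c₁ * T.lin (e * star e) * c₁ + star c₁ * T.lin (e * x) * c₂ +
          (star c₂ * T.lin (star (e * x)) * c₁ + star c₂ * T.lin (star x * x) * c₂)) :=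
      fun c₁ hc₁ c₂ hc₂ => by
      have := hT.sum_nonneg_one Finset.univ ![1, g] ![star e, x] ![c₁, c₂]
        (by simpa [Fin.forall_fin_two] using ⟨star_mem_homog inv_one he, hx⟩)
        (by simpa [Fin.forall_fin_two] using ⟨hc₁, hc₂⟩)
      simpa [Fin.sum_univ_two] using IsSelfAdjoint.of_nonneg this
    -- Polarization: the diagonal terms are selfadjoint, and comparing c₂ with i c₂ separates the
    -- two cross terms.
    have hcross : ∀ c₁ ∈ B.homog 1, ∀ c₂ ∈ B.homog (φ g)⁻¹,
        star c₁ * T.lin (e * x) * c₂ = star (star c₂ * T.lin (star (e * x)) * c₁) :=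
      fun c₁ hc₁ c₂ hc₂ => by
      have h1 := (hsa c₁ hc₁ 0 (zero_mem _)).star_eq
      have h2 := (hsa 0 (zero_mem _) c₂ hc₂).star_eq
      have h3 := (hsa c₁ hc₁ c₂ hc₂).star_eq
      have h4 := (hsa c₁ hc₁ (Complex.I • c₂) (Submodule.smul_mem _ _ hc₂)).star_eq
      simp only [mul_zero, star_zero, zero_mul, add_zero, zero_add] at h1 h2
      replace h4 := congrArg (Complex.I • ·) h4
      simp only [star_smul, smul_mul_assoc, mul_smul_comm, smul_smul, smul_add, RCLike.star_def,
        Complex.conj_I, mul_neg, Complex.I_mul_I, neg_neg, map_neg, one_smul,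
        star_add, h1, h2] at h3 h4
      linear_combination (norm := module) (-(1 / 2) : ℂ) • h3 + (1 / 2 : ℂ) • h4
    set W := T.lin (e * x) - star (T.lin (star (e * x))) with hW
    have hWm : W ∈ B.homog (φ g) := sub_mem (T.lin_mem_homog hex)
      (star_mem_homog (by simp) (T.lin_mem_homog (star_mem_homog rfl hex)))
    -- These choices of c₁ and c₂ turn the cross relation into (W W⋆)² = 0.
    have h1 := hcross (W * star W)
      (mul_mem_homog (mul_inv_cancel _) hWm (star_mem_homog rfl hWm)) (star W)
      (star_mem_homog rfl hWm)
    have h2 : (W * star W) * (W * star W) = 0 := by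
      have : W * star W * T.lin (e * x) * star W =
          W * star W * star (T.lin (star (e * x))) * star W := by
        simpa [_root_.mul_assoc] using h1
      calc _ = W * star W * T.lin (e * x) * star W -
            W * star W * star (T.lin (star (e * x))) * star W := by
            nth_rewrite 3 [hW]; noncomm_ring
        _ = 0 := by rw [this, sub_self]
    have h3 : W = 0 := (CStarRing.mul_star_self_eq_zero_iff W).1
      (eq_zero_of_mul_self_eq_zero' (by simp) h2)
    rw [← star_star (T.lin (star (e * x))), ← sub_eq_zero.1 h3]
  have h1 := T.tendsto_lin hx (fun e => mul_mem_homog (one_mul g) (lam_mem_homog 1 e) hx)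
    (tendsto_unit_mul hx)
  have h2 := T.tendsto_lin (star_mem_homog rfl hx)
    (fun e => star_mem_homog rfl (mul_mem_homog (one_mul g) (lam_mem_homog 1 e) hx))
    (tendsto_unit_mul hx).star
  exact tendsto_nhds_unique h2 (h1.star.congr fun e => (step _ (lam_mem_homog 1 e)).symm)

/-- The positivity condition holds for arbitrary shifts of the degrees of the `c_i`. -/
theorem IsPositiveDefinite.sum_nonneg (hT : T.IsPositiveDefinite) {ι : Type*} (s : Finset ι)
    (g : ι → G) (k : H) (x : ι → A.Cr) (c : ι → B.Cr) (hx : ∀ i ∈ s, x i ∈ A.homog (g i))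
    (hc : ∀ i ∈ s, c i ∈ B.homog ((φ (g i))⁻¹ * k)) :
    0 ≤ ∑ i ∈ s, ∑ j ∈ s, star (c i) * T.lin (star (x i) * x j) * c j := by
  classical
  induction s using Finset.strongInduction generalizing k x c with
  | H s ih =>
  have hxx : ∀ (y : ι → A.Cr), (∀ i ∈ s, y i ∈ A.homog (g i)) → ∀ i ∈ s, ∀ j ∈ s,
      star (y i) * y j ∈ A.homog ((g i)⁻¹ * g j) := fun y hy i hi j hj =>
    mul_mem_homog rfl (star_mem_homog rfl (hy i hi)) (hy j hj)
  -- the case in which the shift is one of the degrees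
  have main : ∀ l ∈ s, ∀ c : ι → B.Cr, (∀ i ∈ s, c i ∈ B.homog ((φ (g i))⁻¹ * φ (g l))) →
      0 ≤ ∑ i ∈ s, ∑ j ∈ s, star (c i) * T.lin (star (x i) * x j) * c j := by
    intro l hl c hc
    -- The error consists of row l and column l of the remainder matrix Q. Each entry has a factor
    -- ‖x'_l‖ ≤ δ, the other factor being bounded by ‖x'_j‖ ≤ 2 ‖x_j‖.
    refine nonneg_of_forall_approx (∑ j ∈ s, ‖c l‖ * (‖T ((g l)⁻¹ * g j)‖ * (2 * ‖x j‖)) * ‖c j‖ +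
      ∑ i ∈ s.erase l, ‖c i‖ * (‖T ((g i)⁻¹ * g l)‖ * (2 * ‖x i‖)) * ‖c l‖) fun δ hδ => ?_
    obtain ⟨X, hX⟩ := mul_mem_homog (mul_inv_cancel (g l)) (hx l hl) (star_mem_homog rfl (hx l hl))
    obtain ⟨f, w, hf, hw, hf1, hfw, hfX⟩ := exists_soft_projection
      (lam_one_nonneg_iff.1 (hX.symm ▸ mul_star_self_nonneg (x l))) (ε := δ ^ 2) (by positivity)
    have hf' : star (A.lam 1 f) = A.lam 1 f := by rw [← lam_one_star, hf]
    have hw' : star (A.lam 1 w) = A.lam 1 w := by rw [← lam_one_star, hw]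
    have hfw' : A.lam 1 f + A.lam 1 f - A.lam 1 f * A.lam 1 f =
        A.lam 1 w * (x l * star (x l)) * A.lam 1 w := by
      rw [← hX, ← lam_one_mul, ← lam_one_mul, ← lam_one_mul, ← hfw, map_sub, map_add]
    -- As 1 - (1 - f)² = w x_l x_l⋆ w, the part of x_i⋆ x_j cut off by f factors through x_l and
    -- equals y_i⋆ y_j. Passing from x_i to y_i changes the degree from g_i to g_l⁻¹ g_i, which
    -- absorbs the shift φ(g_l).
    let x' : ι → A.Cr := fun i => x i - A.lam 1 f * x i
    let y : ι → A.Cr := fun i => star (x l) * A.lam 1 w * x i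
    have hx' : ∀ i ∈ s, x' i ∈ A.homog (g i) := fun i hi =>
      sub_mem (hx i hi) (mul_mem_homog (one_mul _) (lam_mem_homog 1 f) (hx i hi))
    have hy : ∀ i ∈ s, y i ∈ A.homog ((g l)⁻¹ * g i) := fun i hi =>
      mul_mem_homog rfl (mul_mem_homog (mul_one _) (star_mem_homog rfl (hx l hl))
        (lam_mem_homog 1 w)) (hx i hi)
    have hsplit : ∀ i j, star (x i) * x j = star (y i) * y j + star (x' i) * x' j := fun i j => by
      simp only [x', y, star_mul, star_sub, star_star, hf', hw']
      have e1 : star (x i) * (A.lam 1 w * x l) * (star (x l) * A.lam 1 w * x j) =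
          star (x i) * (A.lam 1 f + A.lam 1 f - A.lam 1 f * A.lam 1 f) * x j := by
        rw [hfw']; noncomm_ring
      rw [e1]
      noncomm_ring
    have hxl : ‖x' l‖ ≤ δ := by
      refine abs_le_of_sq_le_sq' ?_ hδ.le |>.2
      -- Here x'_l x'_l⋆ = (1 - f) x_l x_l⋆ (1 - f), which the soft projection makes smaller than δ²
      -- or equal to it.
      rw [sq, ← CStarRing.norm_self_mul_star]
      refine le_trans (le_of_eq ?_) hfX
      rw [← norm_lam (A := A) 1]
      congr 1
      simp only [map_add, map_sub, lam_one_mul, hX, x', star_sub, star_mul, hf']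
      noncomm_ring
    have hxn : ∀ i, ‖x' i‖ ≤ 2 * ‖x i‖ := fun i => by
      refine (norm_sub_le _ _).trans ?_
      have := (_root_.norm_mul_le (A.lam 1 f) (x i)).trans
        (mul_le_mul_of_nonneg_right ((norm_lam 1 f).trans_le hf1) (norm_nonneg _))
      linarith
    let Q : ι → ι → B.Cr := fun i j => star (c i) * T.lin (star (x' i) * x' j) * c j
    have hQ : ∀ i ∈ s, ∀ j ∈ s, ∀ r₁ r₂ : ℝ, ‖x' i‖ ≤ r₁ → ‖x' j‖ ≤ r₂ →
        ‖Q i j‖ ≤ ‖c i‖ * (‖T ((g i)⁻¹ * g j)‖ * (r₁ * r₂)) * ‖c j‖ :=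
      fun i hi j hj r₁ r₂ h₁ h₂ => by
      have h0 : 0 ≤ r₁ := (norm_nonneg _).trans h₁
      calc ‖Q i j‖ ≤ ‖star (c i)‖ * ‖T.lin (star (x' i) * x' j)‖ * ‖c j‖ :=
            (_root_.norm_mul_le _ _).trans (by gcongr; exact _root_.norm_mul_le _ _)
        _ ≤ ‖c i‖ * (‖T ((g i)⁻¹ * g j)‖ * (‖star (x' i)‖ * ‖x' j‖)) * ‖c j‖ := by
            rw [norm_star]
            gcongr
            exact (T.norm_lin_le (hxx x' hx' i hi j hj)).trans
              (by gcongr; exact _root_.norm_mul_le _ _)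
        _ ≤ _ := by rw [norm_star]; gcongr
    refine ⟨∑ j ∈ s, Q l j + ∑ i ∈ s.erase l, Q i l, ?_, ?_⟩
    · refine (norm_add_le _ _).trans ?_
      rw [add_mul, Finset.sum_mul, Finset.sum_mul]
      refine add_le_add ((norm_sum_le _ _).trans (Finset.sum_le_sum fun j hj => ?_))
        ((norm_sum_le _ _).trans (Finset.sum_le_sum fun i hi => ?_))
      · refine (hQ l hl j hj _ _ hxl (hxn j)).trans_eq (by ring)
      · refine (hQ i (Finset.mem_of_mem_erase hi) l hl _ _ (hxn i) hxl).trans_eq (by ring)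
    -- The y-part is an instance of the definition; the x'-part over the indices other than l is
    -- covered by the induction hypothesis.
    · have h1 : 0 ≤ ∑ i ∈ s, ∑ j ∈ s, star (c i) * T.lin (star (y i) * y j) * c j :=
        hT.sum_nonneg_one s (fun i => (g l)⁻¹ * g i) y c hy fun i hi => by
          simpa [mul_inv_rev] using hc i hi
      have h2 : 0 ≤ ∑ i ∈ s.erase l, ∑ j ∈ s.erase l, Q i j :=
        ih (s.erase l) (Finset.erase_ssubset hl) (φ (g l)) x' c
          (fun i hi => hx' i (Finset.mem_of_mem_erase hi))
          (fun i hi => hc i (Finset.mem_of_mem_erase hi))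
      refine (add_nonneg h1 h2).trans_eq ?_
      have e1 : ∑ i ∈ s, ∑ j ∈ s, star (c i) * T.lin (star (x i) * x j) * c j =
          ∑ i ∈ s, ∑ j ∈ s, star (c i) * T.lin (star (y i) * y j) * c j +
            ∑ i ∈ s, ∑ j ∈ s, Q i j := by
        simp only [← Finset.sum_add_distrib]
        refine Finset.sum_congr rfl fun i _ => Finset.sum_congr rfl fun j _ => ?_
        rw [hsplit, map_add, mul_add, add_mul]
      have e2 : ∑ i ∈ s, ∑ j ∈ s, Q i j = ∑ i ∈ s.erase l, ∑ j ∈ s.erase l, Q i j +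
          (∑ j ∈ s, Q l j + ∑ i ∈ s.erase l, Q i l) := by
        rw [← Finset.sum_erase_add _ _ hl]
        have : ∀ i, ∑ j ∈ s, Q i j = ∑ j ∈ s.erase l, Q i j + Q i l := fun i =>
          (Finset.sum_erase_add _ _ hl).symm
        rw [Finset.sum_congr rfl fun i _ => this i, Finset.sum_add_distrib]
        abel
      rw [e1, e2]
      abel
  have hcomm : ∀ d : B.Cr, star d * (∑ i ∈ s, ∑ j ∈ s, star (c i) * T.lin (star (x i) * x j) * c j)
      * d = ∑ i ∈ s, ∑ j ∈ s, star (c i * d) * T.lin (star (x i) * x j) * (c j * d) := fun d => by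
    simp only [Finset.mul_sum, Finset.sum_mul, star_mul, _root_.mul_assoc]
  -- An element d of degree k⁻¹ φ(g_l) moves each c_i to degree φ(g_i)⁻¹ φ(g_l), which is the case
  -- `main`.
  refine nonneg_of_conj_homog ?_ ?_ s (fun i => (φ (g i))⁻¹ * k) c
    (fun i => ∑ j ∈ s, T.lin (star (x i) * x j) * c j) hc ?_ ?_
  · refine sum_mem fun i hi => sum_mem fun j hj => ?_
    exact mul_mem_homog (g := k⁻¹ * φ (g j)) (by group)
      (mul_mem_homog (by simp) (star_mem_homog rfl (hc i hi))
      (T.lin_mem_homog (hxx x hx i hi j hj))) (hc j hj)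
  · simp only [star_sum]
    rw [Finset.sum_comm]
    refine Finset.sum_congr rfl fun i hi => Finset.sum_congr rfl fun j hj => ?_
    rw [star_mul, star_mul, star_star, ← hT.lin_star (hxx x hx j hj i hi), star_mul, star_star,
      _root_.mul_assoc]
  · simp only [Finset.mul_sum, _root_.mul_assoc]
  · intro l hl d hd
    rw [hcomm]
    refine main l hl _ fun i hi => mul_mem_homog ?_ (hc i hi) hd
    group

end BundleMap

/-! ### Positivity of the operator-valued forms -/

namespace FellBundle

variable {H : Type v} [Group H] {B : FellBundle.{v, w'} H}

/-- Continuity of the inner product of `ℓ²(B)`. -/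
theorem continuous_inner_L2 {X : Type*} [TopologicalSpace X] {f g : X → B.L2} (hf : Continuous f)
    (hg : Continuous g) : Continuous fun t => ⟪f t, g t⟫_(B.fiber 1)ᵐᵒᵖ :=
  completion_inner_cont _ _ hf hg

/-! ### Inner product rules specialized to ℓ²(B) -/

namespace L2

variable (x y z : B.L2)

theorem inner_add_left :
    ⟪x + y, z⟫_(B.fiber 1)ᵐᵒᵖ = ⟪x, z⟫_(B.fiber 1)ᵐᵒᵖ + ⟪y, z⟫_(B.fiber 1)ᵐᵒᵖ :=
  CStarModule.inner_add_left (A := (B.fiber 1)ᵐᵒᵖ) (E := B.L2)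

theorem inner_add_right :
    ⟪x, y + z⟫_(B.fiber 1)ᵐᵒᵖ = ⟪x, y⟫_(B.fiber 1)ᵐᵒᵖ + ⟪x, z⟫_(B.fiber 1)ᵐᵒᵖ :=
  CStarModule.inner_add_right (A := (B.fiber 1)ᵐᵒᵖ) (E := B.L2)

theorem inner_sub_left :
    ⟪x - y, z⟫_(B.fiber 1)ᵐᵒᵖ = ⟪x, z⟫_(B.fiber 1)ᵐᵒᵖ - ⟪y, z⟫_(B.fiber 1)ᵐᵒᵖ :=
  CStarModule.inner_sub_left (A := (B.fiber 1)ᵐᵒᵖ) (E := B.L2)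

theorem inner_sub_right :
    ⟪x, y - z⟫_(B.fiber 1)ᵐᵒᵖ = ⟪x, y⟫_(B.fiber 1)ᵐᵒᵖ - ⟪x, z⟫_(B.fiber 1)ᵐᵒᵖ :=
  CStarModule.inner_sub_right (A := (B.fiber 1)ᵐᵒᵖ) (E := B.L2)

theorem inner_neg_right : ⟪x, -y⟫_(B.fiber 1)ᵐᵒᵖ = -⟪x, y⟫_(B.fiber 1)ᵐᵒᵖ :=
  CStarModule.inner_neg_right (A := (B.fiber 1)ᵐᵒᵖ) (E := B.L2)

theorem inner_zero_right : ⟪x, 0⟫_(B.fiber 1)ᵐᵒᵖ = 0 :=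
  CStarModule.inner_zero_right (A := (B.fiber 1)ᵐᵒᵖ) (E := B.L2)

theorem inner_smul_left (c : ℂ) : ⟪c • x, y⟫_(B.fiber 1)ᵐᵒᵖ = star c • ⟪x, y⟫_(B.fiber 1)ᵐᵒᵖ :=
  CStarModule.inner_smul_left_complex (A := (B.fiber 1)ᵐᵒᵖ) (E := B.L2)

theorem inner_smul_right (c : ℂ) : ⟪x, c • y⟫_(B.fiber 1)ᵐᵒᵖ = c • ⟪x, y⟫_(B.fiber 1)ᵐᵒᵖ :=
  CStarModule.inner_smul_right_complex (A := (B.fiber 1)ᵐᵒᵖ) (E := B.L2)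

theorem inner_sum_right {ι : Type*} (s : Finset ι) (f : ι → B.L2) :
    ⟪x, ∑ i ∈ s, f i⟫_(B.fiber 1)ᵐᵒᵖ = ∑ i ∈ s, ⟪x, f i⟫_(B.fiber 1)ᵐᵒᵖ :=
  CStarModule.inner_sum_right (A := (B.fiber 1)ᵐᵒᵖ) (E := B.L2)

theorem star_inner : star ⟪x, y⟫_(B.fiber 1)ᵐᵒᵖ = ⟪y, x⟫_(B.fiber 1)ᵐᵒᵖ :=
  CStarModule.star_inner (A := (B.fiber 1)ᵐᵒᵖ) (E := B.L2) x y

theorem inner_self_nonneg : 0 ≤ ⟪x, x⟫_(B.fiber 1)ᵐᵒᵖ :=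
  CStarModule.inner_self_nonneg (A := (B.fiber 1)ᵐᵒᵖ) (E := B.L2)

theorem inner_self_eq_zero : ⟪x, x⟫_(B.fiber 1)ᵐᵒᵖ = 0 ↔ x = 0 :=
  CStarModule.inner_self (A := (B.fiber 1)ᵐᵒᵖ) (E := B.L2)

theorem norm_sq_eq : ‖x‖ ^ 2 = ‖⟪x, x⟫_(B.fiber 1)ᵐᵒᵖ‖ :=
  CStarModule.norm_sq_eq (B.fiber 1)ᵐᵒᵖ (E := B.L2)

theorem norm_inner_le : ‖⟪x, y⟫_(B.fiber 1)ᵐᵒᵖ‖ ≤ ‖x‖ * ‖y‖ :=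
  CStarModule.norm_inner_le (A := (B.fiber 1)ᵐᵒᵖ) B.L2

end L2

/-- An operator in `C_r⋆(B)` with positive quadratic form is positive. -/
theorem nonneg_of_inner_nonneg {W : B.Cr}
    (h : ∀ ξ : B.L2, 0 ≤ ⟪ξ, B.act W ξ⟫_(B.fiber 1)ᵐᵒᵖ) : 0 ≤ W := by
  have hdiag : ∀ ξ : B.L2, ⟪ξ, B.act (W - star W) ξ⟫_(B.fiber 1)ᵐᵒᵖ = 0 := fun ξ => by
    have h1 := (IsSelfAdjoint.of_nonneg (h ξ)).star_eq
    rw [L2.star_inner, inner_act_left] at h1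
    rw [map_sub, sub_apply, L2.inner_sub_right, h1, sub_self]
  -- Polarization: a sesquilinear form with zero diagonal vanishes, here that of W - W⋆.
  have hsa : IsSelfAdjoint W := by
    refine (sub_eq_zero.1 (B.act.injective ?_)).symm
    rw [map_zero]
    ext η
    refine CStarModule.ext_inner_right (R := (B.fiber 1)ᵐᵒᵖ) fun ξ => ?_
    have h1 := hdiag ξ
    have h2 := hdiag η
    have h3 := hdiag (ξ + η)
    have h4 := hdiag (ξ + Complex.I • η)
    simp only [map_add, map_smul, L2.inner_add_left, L2.inner_add_right, L2.inner_smul_left,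
      L2.inner_smul_right, h1, h2, smul_zero, add_zero, zero_add] at h3 h4
    replace h4 := congrArg (Complex.I • ·) h4
    simp only [smul_add, smul_smul, RCLike.star_def, Complex.conj_I, mul_neg, Complex.I_mul_I,
      neg_neg, one_smul, smul_zero] at h4
    rw [_root_.zero_apply, L2.inner_zero_right]
    linear_combination (norm := module) (1 / 2 : ℂ) • h3 - (1 / 2 : ℂ) • h4
  obtain ⟨n, r, hr, hrn, hn, hnz, h0⟩ := hsa.exists_negPart_sqrt
  refine h0 ?_
  -- Evaluating the form at n ξ gives -⟪ξ, n³ ξ⟫ = -⟪r n ξ, r n ξ⟫, which must also be positive.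
  have hrn0 : r * n = 0 := by
    apply B.act.injective
    rw [map_zero]
    ext ξ
    rw [_root_.zero_apply, ← L2.inner_self_eq_zero]
    have h1 := h (B.act n ξ)
    rw [inner_act_left, hn, ← act_mul, ← act_mul, hnz, neg_mul, map_neg, neg_apply,
      L2.inner_neg_right] at h1
    refine le_antisymm ?_ (L2.inner_self_nonneg _)
    rw [inner_act_left, star_mul, hr, hn, ← act_mul,
      show n * r * (r * n) = n * n * n by rw [← _root_.mul_assoc, _root_.mul_assoc n r r, hrn]]
    exact neg_nonneg.1 h1
  refine eq_zero_of_mul_self_eq_zero' hn ?_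
  nth_rewrite 1 [← hrn]
  rw [_root_.mul_assoc, hrn0, mul_zero]

/-- The matrix coefficients of a homogeneous element, computed in `C_r⋆(B)`. -/
theorem lam_one_inner_act {h p q : H} (e : h * q = p) {y : B.Cr} (hy : y ∈ B.homog h)
    (f f' : B.Cc) (S : Finset H) (hS : ∀ k ∉ S, f' (q * k) = 0) :
    B.lam 1 (unop ⟪(f : B.L2), B.act y (f' : B.L2)⟫_(B.fiber 1)ᵐᵒᵖ) =
      ∑ k ∈ S, star (B.lam (p * k) (f (p * k))) * y * B.lam (q * k) (f' (q * k)) := by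
  classical
  obtain ⟨b, rfl⟩ := hy
  have e' : ∀ k, h * (q * k) = p * k := fun k => by rw [← _root_.mul_assoc, e]
  rw [act_lam_coe, completion_inner_coe,
    Cc.inner_eq_sum f _ (S.image (p * ·)) (fun k hk => ?_), unop_op,
    Finset.sum_image fun a _ b _ hab => mul_left_cancel hab, map_sum]
  · refine Finset.sum_congr rfl fun k _ => ?_
    rw [Cc.translate_apply' (e' k), _root_.mul_assoc, lam_mul (e' k), lam_star rfl,
      lam_mul (inv_mul_cancel (p * k))]
  · have hk' : k = p * (p⁻¹ * k) := (mul_inv_cancel_left p k).symm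
    rw [Cc.translate_apply' (k := q * (p⁻¹ * k)) (by rw [e', mul_inv_cancel_left]), hS, map_zero]
    exact fun hm => hk (Finset.mem_image.2 ⟨_, hm, hk'.symm⟩)

end FellBundle

namespace BundleMap

open FellBundle

variable {G : Type u} {H : Type v} [Group G] [Group H] {A : FellBundle.{u, w} G} {φ : G →* H}
  {B : FellBundle.{v, w'} H} {T : BundleMap A φ B}

/-- The inner products decompose as a sum over k in H. The k-th summand involves the values
ξ_i(φ(g_i)⁻¹ k), of degree φ(g_i)⁻¹ k, and is an instance of `sum_nonneg` with shift k. -/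
theorem IsPositiveDefinite.sum_inner_nonneg_homog (hT : T.IsPositiveDefinite) {ι : Type*}
    (s : Finset ι) (g : ι → G) (x : ι → A.Cr) (hx : ∀ i ∈ s, x i ∈ A.homog (g i))
    (ξ : ι → B.Cc) :
    0 ≤ ∑ i ∈ s, ∑ j ∈ s,
      ⟪(ξ i : B.L2), B.act (T.lin (star (x i) * x j)) (ξ j : B.L2)⟫_(B.fiber 1)ᵐᵒᵖ := by
  classical
  choose t ht using fun j => (ξ j).exists_finset
  let S : Finset H := s.biUnion fun j => (t j).image (φ (g j) * ·)
  have hS : ∀ j ∈ s, ∀ k ∉ S, ξ j ((φ (g j))⁻¹ * k) = 0 := fun j hj k hk => by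
    refine ht j _ fun hm => hk ?_
    exact Finset.mem_biUnion.2 ⟨j, hj, Finset.mem_image.2 ⟨_, hm, mul_inv_cancel_left _ _⟩⟩
  rw [← unop_nonneg, ← lam_one_nonneg_iff]
  simp only [Finset.unop_sum, map_sum]
  rw [Finset.sum_congr rfl fun i hi => Finset.sum_congr rfl fun j hj =>
    lam_one_inner_act (h := φ ((g i)⁻¹ * g j)) (p := (φ (g i))⁻¹) (q := (φ (g j))⁻¹) (by simp)
      (T.lin_mem_homog (mul_mem_homog rfl (star_mem_homog rfl (hx i hi)) (hx j hj)))
      (ξ i) (ξ j) S (hS j hj)]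
  rw [Finset.sum_congr rfl fun i _ => Finset.sum_comm, Finset.sum_comm]
  exact Finset.sum_nonneg fun k _ =>
    hT.sum_nonneg s g k x (fun i => B.lam _ (ξ i ((φ (g i))⁻¹ * k))) hx
      fun i _ => lam_mem_homog _ _

/-- The form `(F, ξ), (F', ξ') ↦ ⟪ξ, φ_T(F⋆ F') ξ'⟫` is positive. -/
theorem IsPositiveDefinite.sum_inner_nonneg (hT : T.IsPositiveDefinite) {ι : Type*}
    (s : Finset ι) (F : ι → A.Cr) (hF : ∀ i, F i ∈ A.algCr) (ξ : ι → B.L2) :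
    0 ≤ ∑ i ∈ s, ∑ j ∈ s,
      ⟪ξ i, B.act (T.lin (star (F i) * F j)) (ξ j)⟫_(B.fiber 1)ᵐᵒᵖ := by
  have hd : DenseRange (Pi.map fun (_ : ι) (f : B.Cc) => (f : B.L2)) :=
    DenseRange.piMap fun _ => Completion.denseRange_coe
  refine hd.induction_on (p := fun ξ => 0 ≤ ∑ i ∈ s, ∑ j ∈ s,
      ⟪ξ i, B.act (T.lin (star (F i) * F j)) (ξ j)⟫_(B.fiber 1)ᵐᵒᵖ) ξ ?_ fun f => ?_
  · refine CStarAlgebra.isClosed_nonneg.preimage (continuous_finsetSum _ fun i _ =>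
      continuous_finsetSum _ fun j _ => continuous_inner_L2 (continuous_apply i) ?_)
    exact (B.act _).continuous.comp (continuous_apply j)
  -- Each F_i is split into homogeneous parts; the new index is a pair (i, g), and the vector
  -- depends on i alone.
  choose t y hy hFy using fun i => exists_eq_sum_homog (hF i)
  have h := hT.sum_inner_nonneg_homog (s.sigma t) (fun p => p.2) (fun p => y p.1 p.2)
    (fun p _ => hy p.1 p.2) (fun p => f p.1)
  refine h.trans_eq ?_
  rw [Finset.sum_sigma]
  refine Finset.sum_congr rfl fun i _ => ?_
  rw [Finset.sum_congr rfl fun g _ => Finset.sum_sigma _ _ _, Finset.sum_comm]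
  refine Finset.sum_congr rfl fun j _ => ?_
  rw [hFy i, hFy j]
  simp only [star_sum, Finset.sum_mul, Finset.mul_sum, map_sum, sum_apply,
    L2.inner_sum_right, Pi.map_apply]
  rw [Finset.sum_comm]

theorem IsPositiveDefinite.lin_star_mul_self_nonneg (hT : T.IsPositiveDefinite) {F : A.Cr}
    (hF : F ∈ A.algCr) : 0 ≤ T.lin (star F * F) :=
  nonneg_of_inner_nonneg fun ξ => by
    simpa using hT.sum_inner_nonneg {()} (fun _ => F) (fun _ => hF) fun _ => ξ

theorem IsPositiveDefinite.lin_star_of_mem (hT : T.IsPositiveDefinite) {F : A.Cr}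
    (hF : F ∈ A.algCr) : T.lin (star F) = star (T.lin F) := by
  obtain ⟨s, y, hy, rfl⟩ := exists_eq_sum_homog hF
  simp only [star_sum, map_sum]
  exact Finset.sum_congr rfl fun g _ => hT.lin_star (hy g)

end BundleMap

/-! ### Almost invariant vectors on amenable groups -/

section Amenable

variable {K : Type*} [Group K]

/-- An element of `ℓ^∞` from a bounded function. -/
def boundedLp {K : Type*} (f : K → ℝ) (C : ℝ) (h : ∀ x, ‖f x‖ ≤ C) : lp (fun _ : K => ℝ) ⊤ :=
  ⟨f, memℓp_infty ⟨C, by rintro _ ⟨x, rfl⟩; exact h x⟩⟩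

@[simp] theorem boundedLp_apply {K : Type*} (f : K → ℝ) (C : ℝ) (h : ∀ x, ‖f x‖ ≤ C) (x : K) :
    boundedLp f C h x = f x := rfl

open scoped Classical in
/-- The differences `δ_{k y} - δ_y` in `ℓ¹`, for `k` in a finite set. -/
def translationDefect (S : Finset K) (y : K) : S → lp (fun _ : K => ℝ) 1 :=
  fun k => lp.single 1 (k.1 * y) (1 : ℝ) - lp.single 1 y (1 : ℝ)

/-- There are finitely supported probability measures which are almost invariant in `ℓ¹`. -/
theorem IsAmenableGroup.exists_almost_invariant_measure (hK : IsAmenableGroup K) (S : Finset K)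
    {ε : ℝ} (hε : 0 < ε) :
    ∃ p : K →₀ ℝ, (∀ x, 0 ≤ p x) ∧ (p.sum fun _ c => c) = 1 ∧
      ‖Finsupp.linearCombination ℝ (translationDefect S) p‖ < ε := by
  classical
  let P : Set (K →₀ ℝ) := {p | (∀ x, 0 ≤ p x) ∧ (p.sum fun _ c => c) = 1}
  let Φ := Finsupp.linearCombination ℝ (translationDefect S)
  have hP : Convex ℝ P := by
    rintro p ⟨hp, hp1⟩ q ⟨hq, hq1⟩ a b ha hb hab
    refine ⟨fun x => by
      simpa using add_nonneg (mul_nonneg ha (hp x)) (mul_nonneg hb (hq x)), ?_⟩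
    rw [Finsupp.sum_add_index' (fun _ => rfl) (fun _ _ _ => rfl),
      Finsupp.sum_smul_index (fun _ => rfl), Finsupp.sum_smul_index (fun _ => rfl),
      ← Finsupp.mul_sum, ← Finsupp.mul_sum, hp1, hq1]
    simpa using hab
  suffices h : (0 : S → lp (fun _ : K => ℝ) 1) ∈ closure (Φ '' P) by
    obtain ⟨_, ⟨p, hp, rfl⟩, hb⟩ := Metric.mem_closure_iff.1 h ε hε
    exact ⟨p, hp.1, hp.2, by simpa using hb⟩
  by_contra h
  -- Day's convexity argument: otherwise a functional f exceeds some u > 0 on all translation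
  -- defects. Its values on point masses are bounded functions F_k, and ∑ (F_k(k y) - F_k(y)) > u
  -- for all y. An invariant mean sends the left side to 0, which contradicts u > 0.
  obtain ⟨f, u, hu, hf⟩ := geometric_hahn_banach_point_closed (hP.linear_image Φ).closure
    isClosed_closure h
  rw [map_zero] at hu
  let δ : K → lp (fun _ : K => ℝ) 1 := fun x => lp.single 1 x (1 : ℝ)
  let F : S → K → ℝ := fun k x => f (Pi.single k (δ x))
  have hF : ∀ k x, ‖F k x‖ ≤ ‖f‖ := fun k x => by
    refine (f.le_opNorm _).trans ?_
    rw [Pi.norm_single]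
    simp [δ]
  have hfw : ∀ y, f (translationDefect S y) = ∑ k, (F k (k.1 * y) - F k y) := fun y => by
    have : translationDefect S y = ∑ k : S, Pi.single k (δ (k.1 * y) - δ y) := by
      rw [Finset.univ_sum_single]
      rfl
    rw [this, map_sum]
    refine Finset.sum_congr rfl fun k _ => ?_
    rw [Pi.single_sub, map_sub]
  obtain ⟨m, hm0, hm1, hminv⟩ := hK
  let F₀ : S → lp (fun _ : K => ℝ) ⊤ := fun k => boundedLp (F k) _ (hF k)
  let F₁ : S → lp (fun _ : K => ℝ) ⊤ := fun k =>
    boundedLp (fun y => F k (k.1 * y)) _ fun y => hF k (k.1 * y)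
  let I : lp (fun _ : K => ℝ) ⊤ := boundedLp (fun _ => 1) 1 (by simp)
  have h1 : 0 ≤ m (∑ k, (F₁ k - F₀ k) - u • I) := by
    refine hm0 _ fun y => ?_
    have h2 : (∑ k, (F₁ k - F₀ k) - u • I : lp (fun _ : K => ℝ) ⊤) y =
        f (translationDefect S y) - u := by
      rw [hfw]
      rw [lp.coeFn_sub, Pi.sub_apply, lp.coeFn_sum, Finset.sum_apply, lp.coeFn_smul, Pi.smul_apply]
      simp only [lp.coeFn_sub, Pi.sub_apply, F₀, F₁, I, boundedLp_apply, smul_eq_mul, mul_one]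
    have h3 := hf (translationDefect S y) (subset_closure ⟨Finsupp.single y 1,
      ⟨fun x => by rw [Finsupp.single_apply]; split_ifs <;> simp, by simp⟩, by simp [Φ]⟩)
    rw [h2]
    linarith
  have h4 : ∀ k, m (F₁ k) = m (F₀ k) := fun k => hminv k.1 _ _ fun x => rfl
  rw [map_sub, map_sum, map_smul, hm1 I fun x => rfl] at h1
  simp only [map_sub, h4, sub_self, Finset.sum_const_zero, smul_eq_mul, mul_one] at h1
  linarith

theorem linearCombination_translationDefect_apply (S : Finset K) (p : K →₀ ℝ) (k : S) (x : K) :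
    Finsupp.linearCombination ℝ (translationDefect S) p k x = p (k.1⁻¹ * x) - p x := by
  classical
  induction p using Finsupp.induction_linear with
  | zero => simp
  | add p q hp hq =>
    rw [map_add, Pi.add_apply, lp.coeFn_add, Pi.add_apply, hp, hq, Finsupp.add_apply,
      Finsupp.add_apply]
    ring
  | single y c =>
    simp only [Finsupp.linearCombination_single, translationDefect, Pi.smul_apply, lp.coeFn_smul,
      lp.coeFn_sub, Pi.sub_apply, lp.single_apply, Finsupp.single_apply, smul_eq_mul, Pi.single_apply]
    have : x = k.1 * y ↔ y = k.1⁻¹ * x := by rw [eq_inv_mul_iff_mul_eq, eq_comm]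
    simp only [this, eq_comm (a := x) (b := y)]
    split_ifs <;> ring

theorem sq_sqrt_sub_sqrt_le {a b : ℝ} (ha : 0 ≤ a) (hb : 0 ≤ b) : (√a - √b) ^ 2 ≤ |a - b| := by
  have h1 : a - b = (√a - √b) * (√a + √b) := by
    nlinarith [Real.mul_self_sqrt ha, Real.mul_self_sqrt hb]
  rw [h1, abs_mul, ← sq_abs, sq]
  refine mul_le_mul_of_nonneg_left ?_ (abs_nonneg _)
  have h2 := Real.sqrt_nonneg a
  have h3 := Real.sqrt_nonneg b
  rw [abs_of_nonneg (by positivity : 0 ≤ √a + √b)]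
  exact abs_sub_le_iff.2 ⟨by linarith, by linarith⟩

/-- On an amenable group there are finitely supported unit vectors in `ℓ²` whose coefficient
functions are almost `1` on a given finite set. -/
theorem IsAmenableGroup.exists_almost_invariant_vector (hK : IsAmenableGroup K) (S : Finset K)
    {ε : ℝ} (hε : 0 < ε) :
    ∃ ψ : K →₀ ℝ, ∑ x ∈ ψ.support, ψ x * ψ x = 1 ∧
      ∀ k ∈ S, |∑ x ∈ ψ.support, ψ x * ψ (k⁻¹ * x) - 1| ≤ ε := by
  classical
  obtain ⟨p, hp, hp1, hpε⟩ := hK.exists_almost_invariant_measure S hε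
  let ψ : K →₀ ℝ := p.mapRange Real.sqrt Real.sqrt_zero
  have hψ : ∀ x, ψ x = √(p x) := fun x => rfl
  have hψψ : ∀ x, ψ x * ψ x = p x := fun x => Real.mul_self_sqrt (hp x)
  have hsupp : ψ.support ⊆ p.support := Finsupp.support_mapRange
  have hone : ∑ x ∈ ψ.support, ψ x * ψ x = 1 := by
    rw [← hp1, Finsupp.sum]
    refine (Finset.sum_subset hsupp fun x _ hx => ?_).trans
      (Finset.sum_congr rfl fun x _ => hψψ x)
    simp [Finsupp.notMem_support_iff.1 hx]
  refine ⟨ψ, hone, fun k hk => ?_⟩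
  -- On U both ψ and its translate by k have their full mass, so the square of their ℓ² distance is
  -- 2 minus twice the coefficient.
  let U : Finset K := ψ.support ∪ ψ.support.image (k * ·)
  have e1 : ∑ x ∈ U, ψ x * ψ x = 1 := by
    rw [← hone]
    refine (Finset.sum_subset Finset.subset_union_left fun x _ hx => ?_).symm
    simp [Finsupp.notMem_support_iff.1 hx]
  have e2 : ∑ x ∈ U, ψ (k⁻¹ * x) * ψ (k⁻¹ * x) = 1 := by
    have : ∑ x ∈ ψ.support.image (k * ·), ψ (k⁻¹ * x) * ψ (k⁻¹ * x) = 1 := by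
      rw [Finset.sum_image fun a _ b _ hab => mul_left_cancel hab]
      simpa using hone
    rw [← this]
    refine (Finset.sum_subset Finset.subset_union_right fun x _ hx => ?_).symm
    have h0 : ψ (k⁻¹ * x) = 0 := Finsupp.notMem_support_iff.1 fun hm =>
      hx (Finset.mem_image.2 ⟨_, hm, mul_inv_cancel_left k x⟩)
    simp [h0]
  have e3 : ∑ x ∈ ψ.support, ψ x * ψ (k⁻¹ * x) = ∑ x ∈ U, ψ x * ψ (k⁻¹ * x) :=
    Finset.sum_subset Finset.subset_union_left fun x _ hx => by
      simp [Finsupp.notMem_support_iff.1 hx]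
  have e4 : ∑ x ∈ U, (ψ (k⁻¹ * x) - ψ x) ^ 2 = 2 - 2 * ∑ x ∈ U, ψ x * ψ (k⁻¹ * x) := by
    calc _ = ∑ x ∈ U, ψ (k⁻¹ * x) * ψ (k⁻¹ * x) + ∑ x ∈ U, ψ x * ψ x -
          2 * ∑ x ∈ U, ψ x * ψ (k⁻¹ * x) := by
          rw [Finset.mul_sum, ← Finset.sum_add_distrib, ← Finset.sum_sub_distrib]
          exact Finset.sum_congr rfl fun x _ => by ring
      _ = _ := by rw [e1, e2]; ring
  -- Since (√a - √b)² ≤ |a - b|, the squared ℓ² defect of ψ = √p is at most the ℓ¹ defect of p.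
  have e5 : ∑ x ∈ U, (ψ (k⁻¹ * x) - ψ x) ^ 2 ≤ ε := by
    let D := Finsupp.linearCombination ℝ (translationDefect S) p ⟨k, hk⟩
    have h1 : ‖D‖ ≤ ε := (norm_le_pi_norm _ _).trans hpε.le
    have h2 := lp.sum_rpow_le_norm_rpow (p := 1) (by simp) D U
    simp only [ENNReal.toReal_one, Real.rpow_one] at h2
    refine (Finset.sum_le_sum fun x _ => ?_).trans (h2.trans h1)
    rw [linearCombination_translationDefect_apply]
    exact sq_sqrt_sub_sqrt_le (hp _) (hp _)
  have e6 : 0 ≤ ∑ x ∈ U, (ψ (k⁻¹ * x) - ψ x) ^ 2 := Finset.sum_nonneg fun _ _ => sq_nonneg _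
  rw [e3, abs_le]
  constructor <;> linarith

end Amenable

/-! ### Boundedness for the reduced norms -/

namespace BundleMap

open FellBundle

variable {G : Type u} {H : Type v} [Group G] [Group H] {A : FellBundle.{u, w} G} {φ : G →* H}
  {B : FellBundle.{v, w'} H} {T : BundleMap A φ B}

/-- The product of a bundle map with a function on the group. -/
def scale (T : BundleMap A φ B) (c : G → ℝ) : BundleMap A φ B := fun g => (c g : ℂ) • T g

theorem scale_lin (T : BundleMap A φ B) (c : G → ℝ) {g : G} {x : A.Cr} (hx : x ∈ A.homog g) :
    (T.scale c).lin x = (c g : ℂ) • T.lin x := by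
  obtain ⟨a, rfl⟩ := hx
  rw [lin_lam, lin_lam, ← map_smul]
  rfl

/-- Only finitely many coefficients of F matter, each dominated by ‖F‖. The constant depends on the
support, but its mere existence is what `norm_map_conj_le` requires. -/
theorem exists_norm_scale_lin_le (T : BundleMap A φ B) (c : G → ℝ) (s : Finset G)
    (hs : ∀ g ∉ s, c g = 0) :
    ∃ C : ℝ, ∀ F ∈ A.algCr, ‖(T.scale c).lin F‖ ≤ C * ‖F‖ := by
  classical
  refine ⟨∑ g ∈ s, ‖T.scale c g‖, fun F hF => ?_⟩
  obtain ⟨f, rfl⟩ := exists_iota_eq hF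
  obtain ⟨t, ht⟩ := f.exists_finset
  rw [iota_eq_sum f (s ∪ t) fun g hg => ht g fun h => hg (Finset.mem_union_right _ h), map_sum,
    ← iota_eq_sum f (s ∪ t) fun g hg => ht g fun h => hg (Finset.mem_union_right _ h)]
  rw [← Finset.sum_subset (Finset.subset_union_left : s ⊆ s ∪ t) fun g _ hg => by
    rw [scale_lin T c (lam_mem_homog g _), hs g hg, Complex.ofReal_zero, zero_smul],
    Finset.sum_mul]
  refine (norm_sum_le _ _).trans (Finset.sum_le_sum fun g _ => ?_)
  refine ((T.scale c).norm_lin_le (lam_mem_homog g _)).trans ?_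
  rw [norm_lam]
  gcongr
  exact norm_apply_le_norm_iota f g

/-- The coefficient function of a finitely supported vector for the regular representation. -/
def coefficient (ψ : G →₀ ℝ) (g : G) : ℝ := ∑ x ∈ ψ.support, ψ x * ψ (g⁻¹ * x)

/-- The substitution t = g x exhibits the coefficient as a Gram kernel in g and g', which is the
source of positivity. -/
theorem coefficient_eq_sum (ψ : G →₀ ℝ) (S : Finset G) (g g' : G)
    (hS : ∀ x ∈ ψ.support, g * x ∈ S) :
    coefficient ψ (g⁻¹ * g') = ∑ t ∈ S, ψ (g⁻¹ * t) * ψ (g'⁻¹ * t) := by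
  classical
  have hsub : ψ.support.image (g * ·) ⊆ S := fun t ht => by
    obtain ⟨x, hx, rfl⟩ := Finset.mem_image.1 ht
    exact hS x hx
  rw [← Finset.sum_subset hsub fun t _ ht => ?_,
    Finset.sum_image fun a _ b _ hab => mul_left_cancel hab]
  · simp [coefficient, _root_.mul_assoc]
  · rw [Finsupp.notMem_support_iff.1 fun hm => ht (Finset.mem_image.2
      ⟨g⁻¹ * t, hm, mul_inv_cancel_left g t⟩), zero_mul]

theorem exists_coefficient_finset (ψ : G →₀ ℝ) : ∃ s : Finset G, ∀ g ∉ s, coefficient ψ g = 0 := by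
  classical
  refine ⟨(ψ.support ×ˢ ψ.support).image fun p => p.1 * p.2⁻¹, fun g hg => ?_⟩
  refine Finset.sum_eq_zero fun x hx => ?_
  have h0 : ψ (g⁻¹ * x) = 0 := Finsupp.notMem_support_iff.1 fun hm => hg <|
    Finset.mem_image.2 ⟨(x, g⁻¹ * x), Finset.mem_product.2 ⟨hx, hm⟩, by simp⟩
  rw [h0, mul_zero]

/-- The product of a positive definite bundle map with a coefficient of the regular representation
is positive. -/
theorem IsPositiveDefinite.scale_coefficient_nonneg (hT : T.IsPositiveDefinite) (ψ : G →₀ ℝ)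
    {F : A.Cr} (hF : F ∈ A.algCr) : 0 ≤ (T.scale (coefficient ψ)).lin (star F * F) := by
  classical
  obtain ⟨s, y, hy, rfl⟩ := exists_eq_sum_homog hF
  let S : Finset G := (s ×ˢ ψ.support).image fun p => p.1 * p.2
  -- Each term of the Gram kernel is a product of weights, absorbed into the homogeneous parts of F,
  -- so a sum of values T(F_t⋆ F_t) results.
  have key : (T.scale (coefficient ψ)).lin (star (∑ g ∈ s, y g) * ∑ g ∈ s, y g) =
      ∑ t ∈ S, T.lin (star (∑ g ∈ s, (ψ (g⁻¹ * t) : ℂ) • y g) *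
        ∑ g ∈ s, (ψ (g⁻¹ * t) : ℂ) • y g) := by
    simp only [star_sum, Finset.sum_mul, Finset.mul_sum, map_sum, star_smul, smul_mul_assoc,
      mul_smul_comm, smul_smul, map_smul, Finset.smul_sum]
    rw [Finset.sum_comm (s := S)]
    refine Finset.sum_congr rfl fun g' hg' => ?_
    rw [Finset.sum_comm (s := S)]
    refine Finset.sum_congr rfl fun g hg => ?_
    rw [scale_lin T _ (mul_mem_homog rfl (star_mem_homog rfl (hy g)) (hy g')),
      coefficient_eq_sum ψ S g g' fun x hx => Finset.mem_image.2
        ⟨(g, x), Finset.mem_product.2 ⟨hg, hx⟩, rfl⟩, Complex.ofReal_sum, Finset.sum_smul]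
    refine Finset.sum_congr rfl fun t _ => ?_
    simp [mul_comm]
  rw [key]
  exact Finset.sum_nonneg fun t _ => hT.lin_star_mul_self_nonneg
    (sum_mem fun g _ => SMulMemClass.smul_mem _ (homog_le_algCr (hy g)))

theorem norm_lin_star_mul_self_le (T : BundleMap A φ B) {v : A.Cr} (hv : v ∈ A.homog 1) :
    ‖T.lin (star v * v)‖ ≤ ‖T 1‖ * ‖v‖ ^ 2 := by
  refine (T.norm_lin_le (mul_mem_homog (one_mul 1) (star_mem_homog inv_one hv) hv)).trans_eq ?_
  rw [CStarRing.norm_star_mul_self, sq]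

open scoped Classical in
/-- The indicator function of the kernel of `φ`. -/
def kerIndicator (φ : G →* H) (g : G) : ℝ := if g ∈ φ.ker then 1 else 0

/-- An almost invariant unit vector on the kernel is extended by zero to G. Its coefficients are
near 1 on the given elements of the kernel and vanish off the kernel, where the translate has
disjoint support. -/
theorem exists_coefficient_near_kerIndicator (hφ : IsAmenableGroup φ.ker) (s : Finset G) {ε : ℝ}
    (hε : 0 < ε) :
    ∃ ψ : G →₀ ℝ, coefficient ψ 1 = 1 ∧ ∀ g ∈ s, |coefficient ψ g - kerIndicator φ g| ≤ ε := by
  classical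
  obtain ⟨ψ₀, h1, h2⟩ := hφ.exists_almost_invariant_vector (s.subtype (· ∈ φ.ker)) hε
  let j : φ.ker ↪ G := ⟨Subtype.val, Subtype.val_injective⟩
  let ψ : G →₀ ℝ := ψ₀.embDomain j
  have hψ : ∀ k : φ.ker, ψ k = ψ₀ k := fun k => Finsupp.embDomain_apply_self j ψ₀ k
  have hψ' : ∀ g ∉ φ.ker, ψ g = 0 := fun g hg =>
    Finsupp.embDomain_of_notMem_range _ _ _ (by rintro ⟨k, rfl⟩; exact hg k.2)
  have hco : ∀ g, coefficient ψ g = ∑ x ∈ ψ₀.support, ψ₀ x * ψ (g⁻¹ * x) := fun g => by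
    rw [coefficient, Finsupp.support_embDomain, Finset.sum_map]
    exact Finset.sum_congr rfl fun x _ => by rw [← hψ]; rfl
  have hker : ∀ k : φ.ker, coefficient ψ k = ∑ x ∈ ψ₀.support, ψ₀ x * ψ₀ (k⁻¹ * x) := fun k => by
    rw [hco]
    exact Finset.sum_congr rfl fun x _ => by rw [← hψ (k⁻¹ * x)]; rfl
  refine ⟨ψ, ?_, fun g hg => ?_⟩
  · have := hker 1
    simpa [h1] using this
  · rw [kerIndicator]
    split_ifs with hk
    · have := h2 ⟨g, hk⟩ (by simpa using hg)
      rwa [← hker] at this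
    · have : coefficient ψ g = 0 := by
        rw [hco]
        refine Finset.sum_eq_zero fun x _ => ?_
        rw [hψ' _ fun hm => hk ?_, mul_zero]
        have := mul_mem x.2 (inv_mem hm)
        simpa using this
      simpa [this] using hε.le

/-- The a priori bound on the part of `φ_T` over the kernel of `φ`. -/
theorem IsPositiveDefinite.norm_scale_kerIndicator_le (hT : T.IsPositiveDefinite)
    (hφ : IsAmenableGroup φ.ker) {v : A.Cr} (hv : v ∈ A.homog 1) {F : A.Cr} (hF : F ∈ A.algCr) :
    ‖(T.scale (kerIndicator φ)).lin (star (F * v) * (F * v))‖ ≤ ‖T 1‖ * ‖v‖ ^ 2 * ‖F‖ ^ 2 := by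
  have hv' := homog_le_algCr hv
  obtain ⟨s, y, hy, hX⟩ := exists_eq_sum_homog (mul_mem (star_mem (mul_mem hF hv')) (mul_mem hF hv'))
  refine le_of_forall_pos_le_add fun δ hδ => ?_
  set C := ∑ g ∈ s, ‖T.lin (y g)‖ with hC
  have hC0 : 0 ≤ C := Finset.sum_nonneg fun _ _ => norm_nonneg _
  -- The total error is at most C δ / (C + 1) ≤ δ; the added 1 covers C = 0.
  obtain ⟨ψ, hψ1, hψ⟩ := exists_coefficient_near_kerIndicator (φ := φ) hφ s
    (ε := δ / (C + 1)) (by positivity)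
  obtain ⟨t, ht⟩ := exists_coefficient_finset ψ
  obtain ⟨D, hD⟩ := T.exists_norm_scale_lin_le (coefficient ψ) t ht
  -- The bound D depends on ψ, but the self-improving estimate removes it: only the value at v⋆ v
  -- remains, where the multiplier equals 1.
  have h1 : ‖(T.scale (coefficient ψ)).lin (star (F * v) * (F * v))‖ ≤
      ‖T 1‖ * ‖v‖ ^ 2 * ‖F‖ ^ 2 := by
    refine (norm_map_conj_le A.algCr (T.scale (coefficient ψ)).lin
      (fun y hy => hT.scale_coefficient_nonneg ψ hy) hv' (C := |D| * ‖v‖ ^ 2) ?_ hF).trans ?_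
    · intro F hF
      refine (hD _ (mul_mem (star_mem (mul_mem hF hv')) (mul_mem hF hv'))).trans ?_
      rw [CStarRing.norm_star_mul_self]
      calc D * (‖F * v‖ * ‖F * v‖) ≤ |D| * ((‖F‖ * ‖v‖) * (‖F‖ * ‖v‖)) := by
            gcongr
            · exact le_abs_self D
            · exact _root_.norm_mul_le _ _
            · exact _root_.norm_mul_le _ _
        _ = _ := by ring
    · rw [scale_lin T _ (mul_mem_homog (one_mul 1) (star_mem_homog inv_one hv) hv), hψ1,
        Complex.ofReal_one, one_smul]
      gcongr
      exact T.norm_lin_star_mul_self_le hv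
  have h2 : ‖(T.scale (kerIndicator φ)).lin (star (F * v) * (F * v)) -
      (T.scale (coefficient ψ)).lin (star (F * v) * (F * v))‖ ≤ δ := by
    rw [hX, map_sum, map_sum, ← Finset.sum_sub_distrib]
    calc _ ≤ ∑ g ∈ s, δ / (C + 1) * ‖T.lin (y g)‖ := by
          refine (norm_sum_le _ _).trans (Finset.sum_le_sum fun g hg => ?_)
          rw [scale_lin T _ (hy g), scale_lin T _ (hy g), ← sub_smul, norm_smul, norm_sub_rev,
            ← Complex.ofReal_sub, Complex.norm_real]
          gcongr
          exact hψ g hg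
      _ = δ * (C / (C + 1)) := by rw [← Finset.mul_sum, ← hC]; ring
      _ ≤ δ * 1 := by
          gcongr
          rw [div_le_one (by positivity)]
          linarith
      _ = δ := mul_one δ
  calc _ = ‖(T.scale (coefficient ψ)).lin (star (F * v) * (F * v)) +
        ((T.scale (kerIndicator φ)).lin (star (F * v) * (F * v)) -
          (T.scale (coefficient ψ)).lin (star (F * v) * (F * v)))‖ := by congr 1; abel
    _ ≤ _ := (norm_add_le _ _).trans (add_le_add h1 h2)

/-- An element of degree φ(g) moves a vector at h to φ(g) h, which is orthogonal to it unless g lies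
in the kernel. -/
theorem inner_single_act_lin (T : BundleMap A φ B) (h : H) (b : B.fiber h) {X : A.Cr}
    (hX : X ∈ A.algCr) :
    ⟪((Cc.single h b : B.Cc) : B.L2), B.act (T.lin X) (Cc.single h b : B.Cc)⟫_(B.fiber 1)ᵐᵒᵖ =
      ⟪((Cc.single h b : B.Cc) : B.L2),
        B.act ((T.scale (kerIndicator φ)).lin X) (Cc.single h b : B.Cc)⟫_(B.fiber 1)ᵐᵒᵖ := by
  obtain ⟨s, y, hy, rfl⟩ := exists_eq_sum_homog hX
  simp only [map_sum, sum_apply, L2.inner_sum_right]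
  refine Finset.sum_congr rfl fun g _ => ?_
  rw [scale_lin T _ (hy g), kerIndicator]
  split_ifs with hg
  · simp
  · obtain ⟨t, ht⟩ := T.lin_mem_homog (hy g)
    rw [Complex.ofReal_zero, zero_smul, map_zero, _root_.zero_apply, L2.inner_zero_right, ← ht,
      act_lam_coe, Cc.translate_single (k := φ g * h) rfl, completion_inner_coe,
      Cc.inner_eq_sum _ _ {φ g * h} fun k hk => Cc.single_of_ne (by simpa using hk) _]
    rw [Finset.sum_singleton, Cc.single_of_ne, map_zero, map_zero, LinearMap.zero_apply, op_zero]
    exact fun he => hg (by simpa using he)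

theorem IsPositiveDefinite.inner_act_lin_nonneg (hT : T.IsPositiveDefinite) {F : A.Cr}
    (hF : F ∈ A.algCr) (ξ : B.L2) :
    0 ≤ ⟪ξ, B.act (T.lin (star F * F)) ξ⟫_(B.fiber 1)ᵐᵒᵖ := by
  simpa using hT.sum_inner_nonneg {()} (fun _ => F) (fun _ => hF) fun _ => ξ

/-- The constant may depend on ξ. For one fiber the bound over the kernel applies; sums follow from
the parallelogram inequality, q(ξ + η) ≤ 2 q(ξ) + 2 q(η) for a positive form q. -/
theorem IsPositiveDefinite.exists_norm_inner_le (hT : T.IsPositiveDefinite)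
    (hφ : IsAmenableGroup φ.ker) {v : A.Cr} (hv : v ∈ A.homog 1) (ξ : B.Cc) :
    ∃ C : ℝ, ∀ F ∈ A.algCr,
      ‖⟪(ξ : B.L2), B.act (T.lin (star (F * v) * (F * v))) (ξ : B.L2)⟫_(B.fiber 1)ᵐᵒᵖ‖ ≤
        C * ‖F‖ ^ 2 := by
  have hv' := homog_le_algCr hv
  induction ξ using Cc.induction with
  | zero => exact ⟨0, fun F _ => by
    rw [Completion.coe_zero, map_zero, L2.inner_zero_right]; simp⟩
  | single h b =>
    refine ⟨‖b‖ * (‖T 1‖ * ‖v‖ ^ 2) * ‖b‖, fun F hF => ?_⟩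
    rw [T.inner_single_act_lin h b (mul_mem (star_mem (mul_mem hF hv')) (mul_mem hF hv'))]
    refine (L2.norm_inner_le _ _).trans ?_
    rw [Completion.norm_coe, Cc.norm_single]
    calc _ ≤ ‖b‖ * (‖T 1‖ * ‖v‖ ^ 2 * ‖F‖ ^ 2 * ‖b‖) := by
          gcongr
          refine (norm_act_apply_le _ _).trans ?_
          rw [Completion.norm_coe, Cc.norm_single]
          gcongr
          exact hT.norm_scale_kerIndicator_le hφ hv hF
      _ = _ := by ring
  | add ξ η hξ hη =>
    obtain ⟨C, hC⟩ := hξ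
    obtain ⟨D, hD⟩ := hη
    refine ⟨2 * C + 2 * D, fun F hF => ?_⟩
    have hX := mul_mem hF hv'
    set X := T.lin (star (F * v) * (F * v))
    have h1 := hT.inner_act_lin_nonneg hX ((ξ : B.L2) - (η : B.L2))
    have h2 := hT.inner_act_lin_nonneg hX ((ξ : B.L2) + (η : B.L2))
    rw [Completion.coe_add]
    have h3 : ⟪(ξ : B.L2) + (η : B.L2), B.act X ((ξ : B.L2) + (η : B.L2))⟫_(B.fiber 1)ᵐᵒᵖ ≤
        (2 : ℝ) • ⟪(ξ : B.L2), B.act X (ξ : B.L2)⟫_(B.fiber 1)ᵐᵒᵖ +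
          (2 : ℝ) • ⟪(η : B.L2), B.act X (η : B.L2)⟫_(B.fiber 1)ᵐᵒᵖ := by
      rw [← sub_nonneg]
      convert h1 using 1
      simp only [map_add, map_sub, L2.inner_add_left, L2.inner_add_right, L2.inner_sub_left,
        L2.inner_sub_right]
      module
    refine (CStarAlgebra.norm_le_norm_of_nonneg_of_le h2 h3).trans ((norm_add_le _ _).trans ?_)
    rw [norm_smul, norm_smul, Real.norm_of_nonneg zero_le_two]
    have h4 := hC F hF
    have h5 := hD F hF
    linarith

/-- The quadratic form of `ξ` in the representation of `C_c(A)` associated with `T`. -/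
theorem IsPositiveDefinite.norm_inner_le (hT : T.IsPositiveDefinite)
    (hφ : IsAmenableGroup φ.ker) {v : A.Cr} (hv : v ∈ A.homog 1) (ξ : B.Cc) {F : A.Cr}
    (hF : F ∈ A.algCr) :
    ‖⟪(ξ : B.L2), B.act (T.lin (star (F * v) * (F * v))) (ξ : B.L2)⟫_(B.fiber 1)ᵐᵒᵖ‖ ≤
      ‖T 1‖ * ‖v‖ ^ 2 * ‖ξ‖ ^ 2 * ‖F‖ ^ 2 := by
  obtain ⟨C, hC⟩ := hT.exists_norm_inner_le hφ hv ξ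
  let L : A.Cr →ₗ[ℂ] (B.fiber 1)ᵐᵒᵖ :=
    { toFun := fun X => ⟪(ξ : B.L2), B.act (T.lin X) (ξ : B.L2)⟫_(B.fiber 1)ᵐᵒᵖ
      map_add' := fun X Y => by rw [map_add, map_add, add_apply, L2.inner_add_right]
      map_smul' := fun c X => by
        rw [map_smul, map_smul, smul_apply, L2.inner_smul_right, RingHom.id_apply] }
  -- The constant C from the parallelogram bound is traded for the value of L at v⋆ v.
  refine (norm_map_conj_le A.algCr L (fun y hy => hT.inner_act_lin_nonneg hy _)
    (homog_le_algCr hv) hC hF).trans ?_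
  gcongr
  refine (L2.norm_inner_le _ _).trans ?_
  calc _ ≤ ‖(ξ : B.L2)‖ * (‖T 1‖ * ‖v‖ ^ 2 * ‖(ξ : B.L2)‖) := by
        gcongr
        refine (norm_act_apply_le _ _).trans ?_
        gcongr
        exact T.norm_lin_star_mul_self_le hv
    _ = _ := by rw [Completion.norm_coe]; ring

/-- Cauchy–Schwarz for the positive form at the pairs (e, X η) and (F e, η), where X = T(e⋆ F e):
the cross term is ⟪X η, X η⟫ and both diagonal terms are controlled by ‖T_e‖. -/
theorem IsPositiveDefinite.norm_lin_conj_le (hT : T.IsPositiveDefinite)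
    (hφ : IsAmenableGroup φ.ker) {e : A.Cr} (he : e ∈ A.homog 1) (he1 : ‖e‖ ≤ 1) {F : A.Cr}
    (hF : F ∈ A.algCr) : ‖T.lin (star e * F * e)‖ ≤ ‖T 1‖ * ‖F‖ := by
  have he' := homog_le_algCr he
  set X := T.lin (star e * F * e) with hX
  rw [← B.act.norm_map X]
  refine ContinuousLinearMap.opNorm_le_bound _ (by positivity) fun η => ?_
  refine Completion.induction_on η (isClosed_le (by fun_prop) (by fun_prop)) fun η => ?_
  rw [Completion.norm_coe]
  set ξ := B.act X (η : B.L2) with hξ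
  have hXs : T.lin (star (F * e) * e) = star X := by
    rw [hX, ← hT.lin_star_of_mem (mul_mem (mul_mem (star_mem he') hF) he')]
    simp [_root_.mul_assoc]
  have key := norm_sq_le_of_forall_nonneg (L2.inner_self_nonneg ξ)
    (a := ⟪ξ, B.act (T.lin (star e * e)) ξ⟫_(B.fiber 1)ᵐᵒᵖ)
    (b := ⟪(η : B.L2), B.act (T.lin (star (F * e) * (F * e))) (η : B.L2)⟫_(B.fiber 1)ᵐᵒᵖ)
    fun t => by
      have h := hT.sum_inner_nonneg Finset.univ ![e, F * e]
        (by simpa [Fin.forall_fin_two] using ⟨he', mul_mem hF he'⟩)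
        ![ξ, (-t : ℂ) • (η : B.L2)]
      convert h using 1
      have e1 : ⟪(η : B.L2), B.act (T.lin (star (F * e) * e)) ξ⟫_(B.fiber 1)ᵐᵒᵖ =
          ⟪ξ, ξ⟫_(B.fiber 1)ᵐᵒᵖ := by
        rw [hXs, ← inner_act_left]
      have e2 : ⟪ξ, B.act (T.lin (star e * (F * e))) (η : B.L2)⟫_(B.fiber 1)ᵐᵒᵖ =
          ⟪ξ, ξ⟫_(B.fiber 1)ᵐᵒᵖ := by
        rw [← _root_.mul_assoc, ← hX, ← hξ]
      simp only [Fin.sum_univ_two, Matrix.cons_val_zero, Matrix.cons_val_one, L2.inner_smul_left,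
        L2.inner_smul_right, map_smul, e1, e2, smul_smul]
      simp only [← Complex.coe_smul (_ : ℝ) (_ : (B.fiber 1)ᵐᵒᵖ), RCLike.star_def, map_neg,
        Complex.conj_ofReal]
      push_cast
      module
  rw [← L2.norm_sq_eq] at key
  have h1 : ‖⟪ξ, B.act (T.lin (star e * e)) ξ⟫_(B.fiber 1)ᵐᵒᵖ‖ ≤ ‖T 1‖ * ‖ξ‖ ^ 2 := by
    refine (L2.norm_inner_le _ _).trans ?_
    calc _ ≤ ‖ξ‖ * (‖T 1‖ * 1 ^ 2 * ‖ξ‖) := by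
          gcongr
          refine (norm_act_apply_le _ _).trans ?_
          gcongr
          exact (T.norm_lin_star_mul_self_le he).trans (by gcongr)
      _ = _ := by ring
  have h2 : ‖⟪(η : B.L2), B.act (T.lin (star (F * e) * (F * e))) (η : B.L2)⟫_(B.fiber 1)ᵐᵒᵖ‖ ≤
      ‖T 1‖ * ‖η‖ ^ 2 * ‖F‖ ^ 2 := by
    refine (hT.norm_inner_le hφ he η hF).trans ?_
    calc _ ≤ ‖T 1‖ * 1 ^ 2 * ‖η‖ ^ 2 * ‖F‖ ^ 2 := by gcongr
      _ = _ := by ring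
  have h3 : (‖ξ‖ ^ 2) ^ 2 ≤ (‖T 1‖ * ‖ξ‖ ^ 2) * (‖T 1‖ * ‖η‖ ^ 2 * ‖F‖ ^ 2) :=
    key.trans (by gcongr)
  -- A factor ‖ξ‖² is cancelled from `h3`, so ξ = 0 is treated apart.
  rcases (norm_nonneg ξ).eq_or_lt with h0 | h0
  · rw [← h0]; positivity
  · refine abs_le_of_sq_le_sq' ?_ (by positivity) |>.2
    refine le_of_mul_le_mul_left ?_ (by positivity : 0 < ‖ξ‖ ^ 2)
    calc _ = (‖ξ‖ ^ 2) ^ 2 := by ring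
      _ ≤ _ := h3
      _ = _ := by ring

/-- A positive definite bundle map is bounded by `‖T_e‖` for the reduced norms. -/
theorem IsPositiveDefinite.norm_lin_le_norm_one (hT : T.IsPositiveDefinite)
    (hφ : IsAmenableGroup φ.ker) {F : A.Cr} (hF : F ∈ A.algCr) :
    ‖T.lin F‖ ≤ ‖T 1‖ * ‖F‖ := by
  have h1 : Tendsto (fun e => T.lin (A.lam 1 e * F * A.lam 1 e)) A.unitFilter (𝓝 (T.lin F)) := by
    obtain ⟨s, y, hy, rfl⟩ := exists_eq_sum_homog hF
    simp only [Finset.mul_sum, Finset.sum_mul, map_sum]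
    refine tendsto_finsetSum _ fun g _ => T.tendsto_lin (hy g) (fun e => ?_)
      (tendsto_unit_mul_unit (hy g))
    exact mul_mem_homog (mul_one g) (mul_mem_homog (one_mul g) (lam_mem_homog 1 e) (hy g))
      (lam_mem_homog 1 e)
  refine le_of_tendsto h1.norm ?_
  filter_upwards [A.unitFilter_spec.eventually_norm, A.unitFilter_spec.eventually_star_eq]
    with e he he'
  have h2 := hT.norm_lin_conj_le hφ (lam_mem_homog 1 e) ((norm_lam 1 e).trans_le he) hF
  rwa [← lam_one_star, he'] at h2

end BundleMap

/-! ### Complete positivity -/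

theorem exists_eq_star_mul_self_of_nonneg {R : Type*} [NonUnitalCStarAlgebra R] [PartialOrder R]
    [StarOrderedRing R] {z : R} (hz : 0 ≤ z) : ∃ b, z = star b * b :=
  CStarAlgebra.nonneg_iff_eq_star_mul_self.1 hz

/-! ### Positivity of matrices over a C⋆-algebra -/

section Matrix

variable {n : Type*} [Fintype n] {R : Type*} [NonUnitalCStarAlgebra R] [PartialOrder R]
  [StarOrderedRing R]

/-- Testing on the columns of the negative part N gives the diagonal entries of N Z N = -(r N)⋆ (r
N). They are positive, so every column of r N vanishes. -/
theorem CStarMatrix.nonneg_of_sum_nonneg {Z : CStarMatrix n n R} (hsa : IsSelfAdjoint Z)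
    (h : ∀ b : n → R, 0 ≤ ∑ i, ∑ j, star (b i) * Z i j * b j) : 0 ≤ Z := by
  obtain ⟨N, r, hr, hrN, hN, hNZ, h0⟩ := hsa.exists_negPart_sqrt
  refine h0 (eq_zero_of_mul_self_eq_zero' hN ?_)
  have hNs : ∀ i j, star (N i j) = N j i := fun i j => by
    conv_rhs => rw [← hN]
    rfl
  have hneg : N * Z * N = -(star (r * N) * (r * N)) := by
    rw [hNZ, star_mul, hN, hr, neg_mul]
    congr 1
    calc N * N * N = N * (r * r) * N := by rw [hrN]
      _ = _ := by noncomm_ring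
  have hcol : ∀ p, ∑ q, star ((r * N) q p) * (r * N) q p = 0 := fun p => by
    refine le_antisymm ?_ (Finset.sum_nonneg fun q _ => star_mul_self_nonneg _)
    have h1 := h fun i => N i p
    have h2 : ∑ i, ∑ j, star (N i p) * Z i j * N j p = (N * Z * N) p p := by
      rw [Finset.sum_comm]
      simp only [CStarMatrix.mul_apply, Finset.sum_mul, hNs]
    have h3 : (star (r * N) * (r * N)) p p = ∑ q, star ((r * N) q p) * (r * N) q p := by
      rw [CStarMatrix.mul_apply]
      rfl
    rw [h2, hneg, CStarMatrix.neg_apply, h3] at h1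
    exact neg_nonneg.1 h1
  have hrN0 : r * N = 0 := by
    ext q p
    have := (Finset.sum_eq_zero_iff_of_nonneg fun q _ => star_mul_self_nonneg _).1 (hcol p) q
      (Finset.mem_univ q)
    exact (CStarRing.star_mul_self_eq_zero_iff _).1 this
  nth_rewrite 1 [← hrN]
  rw [mul_assoc, hrN0, mul_zero]

/-- For Z = Y⋆ Y the sum is ∑ z_l⋆ z_l with z_l = ∑ Y_li b_i. -/
theorem CStarMatrix.sum_nonneg_of_nonneg {Z : CStarMatrix n n R} (hZ : 0 ≤ Z) (b : n → R) :
    0 ≤ ∑ i, ∑ j, star (b i) * Z i j * b j := by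
  obtain ⟨Y, rfl⟩ := exists_eq_star_mul_self_of_nonneg hZ
  have : ∑ i, ∑ j, star (b i) * (star Y * Y) i j * b j =
      ∑ l, star (∑ i, Y l i * b i) * ∑ j, Y l j * b j := by
    simp only [CStarMatrix.mul_apply, star_sum, Finset.sum_mul, Finset.mul_sum, star_mul]
    rw [Finset.sum_congr rfl fun i _ => Finset.sum_comm, Finset.sum_comm]
    refine Finset.sum_congr rfl fun l _ => ?_
    rw [Finset.sum_comm]
    refine Finset.sum_congr rfl fun j _ => Finset.sum_congr rfl fun i _ => ?_
    rw [CStarMatrix.star_apply]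
    simp only [mul_assoc]
  rw [this]
  exact Finset.sum_nonneg fun l _ => star_mul_self_nonneg _

end Matrix

/-! ### The reduced map: its norm, its complete positivity and the converse -/

namespace BundleMap

open FellBundle

variable {G : Type u} {H : Type v} [Group G] [Group H] {A : FellBundle.{u, w} G} {φ : G →* H}
  {B : FellBundle.{v, w'} H} {T : BundleMap A φ B}

theorem reducedMap_eq_lin (hT : T.IsReduced) {x : A.Cr} (hx : x ∈ A.algCr) :
    T.reducedMap hT x = T.lin x := by
  obtain ⟨f, rfl⟩ := exists_iota_eq hx
  rw [reducedMap_iota, lin_iota]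

theorem IsPositiveDefinite.norm_iota_sectionMap_le (hT : T.IsPositiveDefinite)
    (hφ : IsAmenableGroup φ.ker) (f : A.Cc) :
    ‖B.iota (T.sectionMap f)‖ ≤ ‖T 1‖ * ‖A.iota f‖ := by
  rw [← lin_iota]
  exact hT.norm_lin_le_norm_one hφ (iota_mem_algCr f)

theorem IsPositiveDefinite.isReduced (hT : T.IsPositiveDefinite) (hφ : IsAmenableGroup φ.ker) :
    T.IsReduced := ⟨‖T 1‖, hT.norm_iota_sectionMap_le hφ⟩

/-- The upper bound passes from the dense range of `A.iota` by continuity. For the lower bound, M_T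
restricts to T_e on the isometric copies of the unit fibers. -/
theorem IsPositiveDefinite.norm_reducedMap (hT : T.IsPositiveDefinite)
    (hφ : IsAmenableGroup φ.ker) (hr : T.IsReduced) : ‖T.reducedMap hr‖ = ‖T 1‖ := by
  apply le_antisymm
  · refine ContinuousLinearMap.opNorm_le_bound _ (norm_nonneg _) fun x => ?_
    refine A.denseRange_iota.induction_on (p := fun x => ‖T.reducedMap hr x‖ ≤ ‖T 1‖ * ‖x‖) x
      (isClosed_le (by fun_prop) (by fun_prop)) fun f => ?_
    rw [reducedMap_iota]
    exact hT.norm_iota_sectionMap_le hφ f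
  · refine ContinuousLinearMap.opNorm_le_bound _ (norm_nonneg _) fun a => ?_
    have h := (T.reducedMap hr).le_opNorm (A.lam 1 a)
    rwa [reducedMap_lam, norm_lam, norm_lam] at h

theorem IsPositiveDefinite.sum_inner_reducedMap_nonneg (hT : T.IsPositiveDefinite)
    (hr : T.IsReduced) {n : ℕ} (y : Fin n → A.Cr) (η : Fin n → B.L2) :
    0 ≤ ∑ i, ∑ j, ⟪η i, B.act (T.reducedMap hr (star (y i) * y j)) (η j)⟫_(B.fiber 1)ᵐᵒᵖ := by
  have hd : DenseRange (Pi.map fun (_ : Fin n) (f : A.Cc) => A.iota f) :=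
    DenseRange.piMap fun _ => A.denseRange_iota
  refine hd.induction_on (p := fun y => 0 ≤ ∑ i, ∑ j,
    ⟪η i, B.act (T.reducedMap hr (star (y i) * y j)) (η j)⟫_(B.fiber 1)ᵐᵒᵖ) y ?_ fun f => ?_
  · refine CStarAlgebra.isClosed_nonneg.preimage (continuous_finsetSum _ fun i _ =>
      continuous_finsetSum _ fun j _ => continuous_inner_L2 continuous_const ?_)
    have h1 : Continuous fun y : Fin n → A.Cr =>
        B.act (T.reducedMap hr (star (y i) * y j)) :=
      B.act.continuous.comp ((T.reducedMap hr).continuous.comp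
        ((continuous_apply i).star.mul (continuous_apply j)))
    exact h1.clm_apply continuous_const
  · have h := hT.sum_inner_nonneg Finset.univ (fun i => A.iota (f i))
      (fun i => iota_mem_algCr (f i)) η
    refine h.trans_eq (Finset.sum_congr rfl fun i _ => Finset.sum_congr rfl fun j _ => ?_)
    rw [Pi.map_apply, Pi.map_apply, reducedMap_eq_lin hr
      (mul_mem (star_mem (iota_mem_algCr (f i))) (iota_mem_algCr (f j)))]

theorem IsPositiveDefinite.reducedMap_star (hT : T.IsPositiveDefinite) (hr : T.IsReduced)
    (x : A.Cr) : T.reducedMap hr (star x) = star (T.reducedMap hr x) := by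
  refine A.denseRange_iota.induction_on
    (p := fun x => T.reducedMap hr (star x) = star (T.reducedMap hr x)) x
    (isClosed_eq ((T.reducedMap hr).continuous.comp continuous_star)
      (T.reducedMap hr).continuous.star) fun f => ?_
  rw [reducedMap_eq_lin hr (iota_mem_algCr f), reducedMap_eq_lin hr (star_mem (iota_mem_algCr f)),
    hT.lin_star_of_mem (iota_mem_algCr f)]

/-- With X = Y⋆ Y, the entry X_ij is ∑ Y_li⋆ Y_lj. For each row l, the form is the positive one of
the family (Y_li)_i at the vectors b_i ξ. -/
theorem IsPositiveDefinite.isCompletelyPositive (hT : T.IsPositiveDefinite) (hr : T.IsReduced) :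
    IsCompletelyPositive (T.reducedMap hr) := by
  refine ⟨⟨(T.reducedMap hr).toLinearMap, fun k X hX => ?_⟩, fun x => rfl⟩
  obtain ⟨Y, rfl⟩ := exists_eq_star_mul_self_of_nonneg hX
  refine CStarMatrix.nonneg_of_sum_nonneg ?_ fun b => nonneg_of_inner_nonneg fun ξ => ?_
  · refine CStarMatrix.ext fun i j => ?_
    rw [CStarMatrix.star_apply, CStarMatrix.map_apply, CStarMatrix.map_apply]
    change star (T.reducedMap hr _) = T.reducedMap hr _
    rw [← hT.reducedMap_star, ← CStarMatrix.star_apply, star_mul, star_star]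
  · have key : ⟪ξ, B.act (∑ i, ∑ j, star (b i) *
        (star Y * Y).map (T.reducedMap hr).toLinearMap i j * b j) ξ⟫_(B.fiber 1)ᵐᵒᵖ =
        ∑ l, ∑ i, ∑ j, ⟪B.act (b i) ξ,
          B.act (T.reducedMap hr (star (Y l i) * Y l j)) (B.act (b j) ξ)⟫_(B.fiber 1)ᵐᵒᵖ := by
      simp only [map_sum, sum_apply, L2.inner_sum_right]
      rw [Finset.sum_comm (s := Finset.univ (α := Fin k)) (t := Finset.univ (α := Fin k))
        (f := fun l i => ∑ j, ⟪B.act (b i) ξ,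
          B.act (T.reducedMap hr (star (Y l i) * Y l j)) (B.act (b j) ξ)⟫_(B.fiber 1)ᵐᵒᵖ)]
      refine Finset.sum_congr rfl fun i _ => ?_
      rw [Finset.sum_comm]
      refine Finset.sum_congr rfl fun j _ => ?_
      rw [act_mul, act_mul, ← inner_act_left, CStarMatrix.map_apply, CStarMatrix.mul_apply]
      change ⟪B.act (b i) ξ, B.act (T.reducedMap hr (∑ l, star (Y l i) * Y l j)) (B.act (b j) ξ)⟫_(B.fiber 1)ᵐᵒᵖ = _
      simp only [map_sum, sum_apply, L2.inner_sum_right]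
    rw [key]
    exact Finset.sum_nonneg fun l _ =>
      hT.sum_inner_reducedMap_nonneg hr (fun i => Y l i) fun i => B.act (b i) ξ

/-- The matrix λ(a_i)⋆ λ(a_j) is the square of a row, hence positive. The entrywise image is
compressed by the λ(b_i)⋆, and the resulting inequality is read back in the unit fiber. -/
theorem IsPositiveDefinite.of_isCompletelyPositive (hr : T.IsReduced)
    (h : IsCompletelyPositive (T.reducedMap hr)) : T.IsPositiveDefinite := by
  obtain ⟨Ψ, hΨ⟩ := h
  intro n g a b
  rw [← lam_one_nonneg_iff, lam_one_sum_eq]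
  let X : CStarMatrix (Fin n) (Fin n) A.Cr :=
    CStarMatrix.ofMatrix fun i j => star (A.lam _ (a i)) * A.lam _ (a j)
  have hX : 0 ≤ X := by
    refine CStarMatrix.nonneg_of_sum_nonneg ?_ fun c => ?_
    · refine CStarMatrix.ext fun i j => ?_
      rw [CStarMatrix.star_apply]
      change star (star (A.lam _ (a j)) * A.lam _ (a i)) = star (A.lam _ (a i)) * A.lam _ (a j)
      rw [star_mul, star_star]
    · have : ∑ i, ∑ j, star (c i) * X i j * c j =
          star (∑ i, A.lam _ (a i) * c i) * ∑ j, A.lam _ (a j) * c j := by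
        simp only [star_sum, Finset.sum_mul, Finset.mul_sum, star_mul]
        rw [Finset.sum_comm]
        refine Finset.sum_congr rfl fun j _ => Finset.sum_congr rfl fun i _ => ?_
        change star (c i) * (star (A.lam _ (a i)) * A.lam _ (a j)) * c j = _
        simp only [_root_.mul_assoc]
      rw [this]
      exact star_mul_self_nonneg _
  have h1 := CStarMatrix.sum_nonneg_of_nonneg (Ψ.map_cstarMatrix_nonneg' n X hX)
    fun i => star (B.lam _ (b i))
  refine h1.trans_eq (Finset.sum_congr rfl fun i _ => Finset.sum_congr rfl fun j _ => ?_)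
  rw [star_star, CStarMatrix.map_apply]
  change B.lam _ (b i) * Ψ (star (A.lam _ (a i)) * A.lam _ (a j)) * star (B.lam _ (b j)) = _
  rw [hΨ, reducedMap_eq_lin hr (mul_mem (star_mem (homog_le_algCr (lam_mem_homog _ _)))
    (homog_le_algCr (lam_mem_homog _ _)))]

end BundleMap

end

theorem theorem3p14 {G : Type u} {H : Type v} [Group G] [Group H] (A : FellBundle.{u, w} G)
    (B : FellBundle.{v, w'} H) (φ : G →* H) (hφ : IsAmenableGroup φ.ker) (T : BundleMap A φ B) :
    (T.IsPositiveDefinite ↔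
      ∃ hT : T.IsReduced, IsCompletelyPositive (T.reducedMap hT)) ∧
    (T.IsPositiveDefinite → ∀ hT : T.IsReduced, ‖T.reducedMap hT‖ = ‖T 1‖) :=
  ⟨⟨fun hT => ⟨hT.isReduced hφ, hT.isCompletelyPositive _⟩,
    fun ⟨hr, h⟩ => BundleMap.IsPositiveDefinite.of_isCompletelyPositive hr h⟩,
    fun hT hr => hT.norm_reducedMap hφ hr⟩
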